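/- Let $\Omega=(a,b)$ be a bounded interval, $\tfrac12<\alpha<1$, $0\le\theta\le1$, $\lambda\in\{0,1\}$ and $f\in L^2(\Omega)$ (all functions real-valued). For $\sigma>0$ let ${}^{-}I^{\sigma}u(x)=\frac1{\Gamma(\sigma)}\int_a^x (x-y)^{\sigma-1}u(y)\,dy$ and ${}^{+}I^{\sigma}u(x)=\frac1{\Gamma(\sigma)}\int_x^b (y-x)^{\sigma-1}u(y)\,dy$, and for $\varphi\in C_c^\infty(\Omega)$ let ${}^{\pm}D^{\alpha}\varphi=\mp\frac{d}{dx}\,{}^{\pm}I^{1-\alpha}\varphi$. For $u\in L^1(\Omega)$, a function $w\in L^1_{loc}(\Omega)$ is the left (resp. right) weak fractional derivative ${}^{-}\mathcal D^{\alpha}u$ (resp. ${}^{+}\mathcal D^{\alpha}u$) if $\int_\Omega w\varphi\,dx=\int_\Omega u\,{}^{+}D^{\alpha}\varphi\,dx$ (resp. $\int_\Omega w\varphi\,dx=\int_\Omega u\,{}^{-}D^{\alpha}\varphi\,dx$) for all $\varphi\in C_c^\infty(\Omega)$. Let ${}^{\pm}H^{\alpha}(\Omega)=\{u\in L^2(\Omega):{}^{\pm}\mathcal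 D^{\alpha}u\in L^2(\Omega)\}$ and $H^\alpha(\Omega)={}^{-}H^{\alpha}(\Omega)\cap{}^{+}H^{\alpha}(\Omega)$. Let ${}^{-}\mathring H^{\alpha}(\Omega)$ be the set of $u\in{}^{-}H^\alpha(\Omega)$ with ${}^{-}I^{1-\alpha}u(a)=0$, and ${}^{+}\mathring H^{\alpha}(\Omega)$ the set of $u\in{}^{+}H^\alpha(\Omega)$ with ${}^{+}I^{1-\alpha}u(b)=0$ (values of the representatives continuous on $[a,b]$). The traces are ${}^{-}Tu=u(b)$ for $u\in{}^{-}H^\alpha(\Omega)$ and ${}^{+}Tu=u(a)$ for $u\in{}^{+}H^\alpha(\Omega)$ (values of the representatives continuous on $(a,b]$ and on $[a,b)$, respectively). Put $$ {}_0\mathcal W^{\alpha,2}_{\theta,\lambda}= \begin{cases} \{u\in{}^{-}\mathring H^{\alpha}(\Omega):{}^{-}Tu=0\} & \theta=0,\ \lambda=0,\\ \{u\in{}^{-}H^{\alpha}(\Omega):{}^{-}Tu=0\} & \theta=0,\ \lambda=1,\\ \{u\in H^{\alpha}(\Omega):{}^{-}Tu={}^{+}Tu=0\} & 0<\theta<1,\\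 \{u\in{}^{+}\mathring H^{\alpha}(\Omega):{}^{+}Tu=0\} & \theta=1,\ \lambda=0,\\ \{u\in{}^{+}H^{\alpha}(\Omega):{}^{+}Tu=0\} & \theta=1,\ \lambda=1, \end{cases} $$ and, for $u,v\in{}_0\mathcal W^{\alpha,2}_{\theta,\lambda}$ (a term with coefficient $0$ being omitted), $$\mathcal E(v)=\int_\Omega \tfrac12\Bigl((1-\theta)|{}^{-}\mathcal D^{\alpha}v|^2+\theta|{}^{+}\mathcal D^{\alpha}v|^2+\lambda|v|^2\Bigr)-fv\,dx,$$ $$a_{\theta,\lambda}(u,v)=\int_\Omega (1-\theta)\,{}^{-}\mathcal D^{\alpha}u\,{}^{-}\mathcal D^{\alpha}v+\theta\,{}^{+}\mathcal D^{\alpha}u\,{}^{+}\mathcal D^{\alpha}v+\lambda uv\,dx,\qquad F(v)=\int_\Omega fv\,dx .$$ Then: (1) A function $u\in{}_0\mathcal W^{\alpha,2}_{\theta,\lambda}$ minimizes $\mathcal E$ over ${}_0\mathcal W^{\alpha,2}_{\theta,\lambda}$ if and only if $a_{\theta,\lambda}(u,v)=F(v)$ for all $v\in{}_0\mathcal W^{\alpha,2}_{\theta,\lambda}$.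 (2) There is exactly one $u\in{}_0\mathcal W^{\alpha,2}_{\theta,\lambda}$ with $a_{\theta,\lambda}(u,v)=F(v)$ for all $v\in{}_0\mathcal W^{\alpha,2}_{\theta,\lambda}$. (3) There is exactly one minimizer of $\mathcal E$ over ${}_0\mathcal W^{\alpha,2}_{\theta,\lambda}$. (Functions that agree almost everywhere are identified.) -/

import Mathlib

open MeasureTheory Set
open scoped ContDiff

namespace FracVar

noncomputable section

/-- Lebesgue measure on `Ω = (a, b)`. -/
abbrev vol (a b : ℝ) : Measure ℝ := volume.restrict (Ioo a b)

/-- The real Hilbert space `L²(Ω)`, `Ω = (a, b)`. -/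
abbrev L2 (a b : ℝ) : Type := Lp ℝ 2 (vol a b)

/-- Left Riemann-Liouville integral of order `σ > 0` with base point `a`. -/
def leftInt (σ a : ℝ) (u : ℝ → ℝ) (x : ℝ) : ℝ :=
  (Real.Gamma σ)⁻¹ * ∫ y in a..x, (x - y) ^ (σ - 1) * u y

/-- Right Riemann-Liouville integral of order `σ > 0` with base point `b`. -/
def rightInt (σ b : ℝ) (u : ℝ → ℝ) (x : ℝ) : ℝ :=
  (Real.Gamma σ)⁻¹ * ∫ y in x..b, (y - x) ^ (σ - 1) * u y

/-- Classical left Riemann-Liouville derivative of order `0 < α < 1`. -/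
def leftDeriv (α a : ℝ) (φ : ℝ → ℝ) (x : ℝ) : ℝ :=
  deriv (leftInt (1 - α) a φ) x

/-- Classical right Riemann-Liouville derivative of order `0 < α < 1`. -/
def rightDeriv (α b : ℝ) (φ : ℝ → ℝ) (x : ℝ) : ℝ :=
  - deriv (rightInt (1 - α) b φ) x

/-- `φ ∈ C_c^∞((a, b))`, already extended by zero to `ℝ`. -/
def IsTest (a b : ℝ) (φ : ℝ → ℝ) : Prop :=
  ContDiff ℝ ∞ φ ∧ HasCompactSupport φ ∧ tsupport φ ⊆ Ioo a b

/-- `v` is a left weak derivative of order `0 < α < 1` of `u` on `(a, b)`. For a test function `φ`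
and `x ∈ (a, b)` the derivative with base point `b` is the one of the zero extension of `φ`. -/
def IsLeftWeakDeriv (α a b : ℝ) (u v : ℝ → ℝ) : Prop :=
  IntegrableOn u (Ioo a b) ∧ LocallyIntegrableOn v (Ioo a b) ∧
    ∀ φ : ℝ → ℝ, IsTest a b φ →
      ∫ x in Ioo a b, v x * φ x = ∫ x in Ioo a b, u x * rightDeriv α b φ x

/-- `v` is a right weak derivative of order `0 < α < 1` of `u` on `(a, b)`. -/
def IsRightWeakDeriv (α a b : ℝ) (u v : ℝ → ℝ) : Prop :=
  IntegrableOn u (Ioo a b) ∧ LocallyIntegrableOn v (Ioo a b) ∧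
    ∀ φ : ℝ → ℝ, IsTest a b φ →
      ∫ x in Ioo a b, v x * φ x = ∫ x in Ioo a b, u x * leftDeriv α a φ x

open Classical in
/-- The left weak derivative (unique up to null sets), and `0` if there is none. -/
def leftWeakDeriv (α a b : ℝ) (u : ℝ → ℝ) : ℝ → ℝ :=
  if h : ∃ v, IsLeftWeakDeriv α a b u v then h.choose else 0

open Classical in
/-- The right weak derivative (unique up to null sets), and `0` if there is none. -/
def rightWeakDeriv (α a b : ℝ) (u : ℝ → ℝ) : ℝ → ℝ :=
  if h : ∃ v, IsRightWeakDeriv α a b u v then h.choose else 0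

/-- The left fractional Sobolev space of order `α` (with `p = 2`). -/
def leftH (α a b : ℝ) : Set (L2 a b) :=
  {u | ∃ v : ℝ → ℝ, IsLeftWeakDeriv α a b u v ∧ MemLp v 2 (vol a b)}

/-- The right fractional Sobolev space of order `α` (with `p = 2`). -/
def rightH (α a b : ℝ) : Set (L2 a b) :=
  {u | ∃ v : ℝ → ℝ, IsRightWeakDeriv α a b u v ∧ MemLp v 2 (vol a b)}

/-- The value at `a` of (the continuous representative of) the left integral of order `1 - α` of
`u` is `c`. The coefficient of `(x - a) ^ (α - 1)` in `u` is a nonzero multiple of this value. -/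
def HasLeftCoeff (α a b : ℝ) (u : ℝ → ℝ) (c : ℝ) : Prop :=
  ∃ g : ℝ → ℝ, ContinuousOn g (Icc a b) ∧ leftInt (1 - α) a u =ᵐ[vol a b] g ∧ g a = c

/-- The value at `b` of (the continuous representative of) the right integral of order `1 - α` of
`u` is `c`. The coefficient of `(b - x) ^ (α - 1)` in `u` is a nonzero multiple of this value. -/
def HasRightCoeff (α a b : ℝ) (u : ℝ → ℝ) (c : ℝ) : Prop :=
  ∃ g : ℝ → ℝ, ContinuousOn g (Icc a b) ∧ rightInt (1 - α) b u =ᵐ[vol a b] g ∧ g b = c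

/-- Elements of the left space without singular part at `a`. -/
def leftRingH (α a b : ℝ) : Set (L2 a b) :=
  {u | u ∈ leftH α a b ∧ HasLeftCoeff α a b u 0}

/-- Elements of the right space without singular part at `b`. -/
def rightRingH (α a b : ℝ) : Set (L2 a b) :=
  {u | u ∈ rightH α a b ∧ HasRightCoeff α a b u 0}

/-- The trace `⁻T u = u(b)` is `c` (value at `b` of the representative continuous on `(a, b]`). -/
def HasLeftTrace (a b : ℝ) (u : ℝ → ℝ) (c : ℝ) : Prop :=
  ∃ g : ℝ → ℝ, ContinuousOn g (Ioc a b) ∧ u =ᵐ[vol a b] g ∧ g b = c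

/-- The trace `⁺T u = u(a)` is `c` (value at `a` of the representative continuous on `[a, b)`). -/
def HasRightTrace (a b : ℝ) (u : ℝ → ℝ) (c : ℝ) : Prop :=
  ∃ g : ℝ → ℝ, ContinuousOn g (Ico a b) ∧ u =ᵐ[vol a b] g ∧ g a = c

open Classical in
/-- The family of spaces `𝒲^{α,2}_{θ,lam}`, for `0 ≤ θ ≤ 1` and `lam ∈ {0, 1}`. -/
def space (α a b θ lam : ℝ) : Set (L2 a b) :=
  if θ = 0 then (if lam = 0 then leftRingH α a b else leftH α a b)
  else if θ = 1 then (if lam = 0 then rightRingH α a b else rightH α a b)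
  else leftH α a b ∩ rightH α a b

/-- The zero-trace spaces `₀𝒲^{α,2}_{θ,lam}`: the left trace vanishes unless `θ = 1`, and the right
trace vanishes unless `θ = 0`. -/
def zeroSpace (α a b θ lam : ℝ) : Set (L2 a b) :=
  {u | u ∈ space α a b θ lam ∧
    (θ ≠ 1 → HasLeftTrace a b u 0) ∧ (θ ≠ 0 → HasRightTrace a b u 0)}

/-- The energy with the quadratic density. -/
def energy (α a b θ lam : ℝ) (f : ℝ → ℝ) (v : L2 a b) : ℝ :=
  ∫ x in Ioo a b,
    ((1 / 2) * ((1 - θ) * |leftWeakDeriv α a b v x| ^ 2 + θ * |rightWeakDeriv α a b v x| ^ 2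
      + lam * |v x| ^ 2) - f x * v x)

/-- The bilinear form `a_{θ,lam}(u, v)`. -/
def bilin (α a b θ lam : ℝ) (u v : L2 a b) : ℝ :=
  ∫ x in Ioo a b,
    ((1 - θ) * (leftWeakDeriv α a b u x * leftWeakDeriv α a b v x)
      + θ * (rightWeakDeriv α a b u x * rightWeakDeriv α a b v x) + lam * (u x * v x))

/-- The load functional `F(v)`. -/
def load (a b : ℝ) (f : ℝ → ℝ) (v : L2 a b) : ℝ :=
  ∫ x in Ioo a b, f x * v x

/-- `u` minimizes the energy over the zero-trace space. -/
def IsMinimizer (α a b θ lam : ℝ) (f : ℝ → ℝ) (u : L2 a b) : Prop :=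
  u ∈ zeroSpace α a b θ lam ∧
    ∀ v ∈ zeroSpace α a b θ lam, energy α a b θ lam f u ≤ energy α a b θ lam f v

/-- `u` solves the weak formulation in the zero-trace space. -/
def IsWeakSolution (α a b θ lam : ℝ) (f : ℝ → ℝ) (u : L2 a b) : Prop :=
  u ∈ zeroSpace α a b θ lam ∧
    ∀ v ∈ zeroSpace α a b θ lam, bilin α a b θ lam u v = load a b f v

end

end FracVar

/-! Everything rests on one representation: if v ∈ L² is the left weak derivative of u, then u = c κ
+ I^α v, where κ(x) = (x-a)^(α-1)/Γ(α) and c is the value of I^(1-α) u at a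
(`IsLeftWeakDeriv.representation`). It holds because the weak equation says that I^(1-α) u has
distributional derivative v, and because I^α I^(1-α) = I^1 makes I^(1-α) injective.

For α > 1/2 the kernel is square integrable, so by Cauchy-Schwarz I^α maps L² boundedly into the
continuous functions on [a, b]. Hence c and the trace at b are continuous functionals on the closed
graph of the derivative, and c = 0 gives a Poincaré inequality ‖u‖ ≤ C ‖v‖. Reflection x ↦ a + b - x
yields the right-sided theory.

The zero-trace space thus becomes a closed subspace of a Hilbert space of triples (u, ⁻D u, ⁺D u),
on which the form is coercive (`tripleForm_coercive`). For lam = 1 the form contains ‖u‖² itself.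
For lam = 0 the singular coefficient vanishes: by definition of the space if θ ∈ {0, 1}, and for 0 <
θ < 1 because a finite trace at a excludes the blow-up of κ. Lax-Milgram solves the weak equation,
and the energy is a convex quadratic whose minimizers are exactly the weak solutions. -/

namespace FracVar

open Filter Topology
open scoped Convolution

/-! ### Fractional integrals as convolutions with truncated kernels -/

/-- The Riemann-Liouville kernel of order `σ`, truncated to `(0, L)`. -/
noncomputable def kernel (σ L : ℝ) : ℝ → ℝ :=
  (Ioo 0 L).indicator fun t => (Real.Gamma σ)⁻¹ * t ^ (σ - 1)

lemma kernel_of_mem {σ L t : ℝ} (ht : t ∈ Ioo 0 L) :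
    kernel σ L t = (Real.Gamma σ)⁻¹ * t ^ (σ - 1) := indicator_of_mem ht _

lemma kernel_of_notMem {σ L t : ℝ} (ht : t ∉ Ioo 0 L) : kernel σ L t = 0 :=
  indicator_of_notMem ht _

lemma kernel_nonneg {σ : ℝ} (hσ : 0 < σ) (L t : ℝ) : 0 ≤ kernel σ L t := by
  refine indicator_nonneg (fun t ht => ?_) t
  have := Real.Gamma_pos_of_pos hσ
  have := ht.1
  positivity

lemma measurable_kernel (σ L : ℝ) : Measurable (kernel σ L) := by
  refine Measurable.indicator ?_ measurableSet_Ioo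
  fun_prop

lemma integrable_kernel {σ : ℝ} (hσ : 0 < σ) (L : ℝ) : Integrable (kernel σ L) := by
  rcases le_or_gt L 0 with hL | hL
  · simp [kernel, Ioo_eq_empty (not_lt.2 hL)]
  refine (integrable_indicator_iff measurableSet_Ioo).2 ?_
  refine IntegrableOn.mono_set ?_ Ioo_subset_Ioc_self
  refine Integrable.const_mul ?_ _
  exact (intervalIntegrable_iff_integrableOn_Ioc_of_le hL.le).1
    (intervalIntegral.intervalIntegrable_rpow' (by linarith))

/-- The square of the kernel of order σ is a multiple of the kernel of order 2σ - 1, which is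
integrable once 2σ - 1 > 0. This is where 1/2 enters. -/
lemma memLp_kernel {σ : ℝ} (hσ : 1 / 2 < σ) (L : ℝ) : MemLp (kernel σ L) 2 volume := by
  refine (memLp_two_iff_integrable_sq (measurable_kernel σ L).aestronglyMeasurable).2 ?_
  have h := (integrable_kernel (σ := 2 * σ - 1) (by linarith) L).const_mul
    (Real.Gamma (2 * σ - 1) * (Real.Gamma σ)⁻¹ ^ 2)
  refine h.congr (ae_of_all _ fun t => ?_)
  by_cases ht : t ∈ Ioo 0 L
  · simp only [kernel_of_mem ht]
    have h0 : Real.Gamma (2 * σ - 1) ≠ 0 := (Real.Gamma_pos_of_pos (by linarith)).ne'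
    have : t ^ (2 * σ - 1 - 1) = (t ^ (σ - 1)) ^ 2 := by
      rw [← Real.rpow_natCast, ← Real.rpow_mul ht.1.le]
      congr 1
      push_cast
      ring
    rw [this]
    field_simp
  · simp [kernel_of_notMem ht]

/-- For y in (a, b) and x in [a, b] the difference x - y is below b - a, so truncating the kernel
loses nothing. It makes the kernel integrable on ℝ, which opens the way to convolution theory. -/
lemma leftInt_eq {a b x : ℝ} (hx : x ∈ Icc a b) (σ : ℝ) (u : ℝ → ℝ) :
    leftInt σ a u x = ∫ y, (Ioo a b).indicator u y * kernel σ (b - a) (x - y) := by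
  rw [leftInt, ← intervalIntegral.integral_const_mul, intervalIntegral.integral_of_le hx.1,
    integral_Ioc_eq_integral_Ioo, ← integral_indicator measurableSet_Ioo]
  congr 1 with y
  by_cases hy : y ∈ Ioo a x
  · rw [indicator_of_mem hy, indicator_of_mem (show y ∈ Ioo a b from ⟨hy.1, hy.2.trans_le hx.2⟩),
      kernel_of_mem ⟨by linarith [hy.2], by linarith [hy.1, hx.2]⟩]
    ring
  · rw [indicator_of_notMem hy]
    by_cases hy' : y ∈ Ioo a b
    · rw [kernel_of_notMem, mul_zero]
      exact fun h => hy ⟨hy'.1, by linarith [h.1]⟩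
    · rw [indicator_of_notMem hy', zero_mul]

lemma rightInt_eq {a b x : ℝ} (hx : x ∈ Icc a b) (σ : ℝ) (u : ℝ → ℝ) :
    rightInt σ b u x = ∫ y, (Ioo a b).indicator u y * kernel σ (b - a) (y - x) := by
  rw [rightInt, ← intervalIntegral.integral_const_mul, intervalIntegral.integral_of_le hx.2,
    integral_Ioc_eq_integral_Ioo, ← integral_indicator measurableSet_Ioo]
  congr 1 with y
  by_cases hy : y ∈ Ioo x b
  · rw [indicator_of_mem hy, indicator_of_mem (show y ∈ Ioo a b from ⟨hx.1.trans_lt hy.1, hy.2⟩),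
      kernel_of_mem ⟨by linarith [hy.1], by linarith [hy.2, hx.1]⟩]
    ring
  · rw [indicator_of_notMem hy]
    by_cases hy' : y ∈ Ioo a b
    · rw [kernel_of_notMem, mul_zero]
      exact fun h => hy ⟨by linarith [h.1], hy'.2⟩
    · rw [indicator_of_notMem hy', zero_mul]

lemma leftInt_eq_convolution {a b x : ℝ} (hx : x ∈ Icc a b) (σ : ℝ) (u : ℝ → ℝ) :
    leftInt σ a u x =
      ((Ioo a b).indicator u ⋆[ContinuousLinearMap.mul ℝ ℝ, volume] kernel σ (b - a)) x :=
  leftInt_eq hx σ u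

lemma leftInt_congr {a b : ℝ} {u v : ℝ → ℝ} (h : u =ᵐ[vol a b] v) (σ : ℝ) {x : ℝ}
    (hx : x ∈ Icc a b) : leftInt σ a u x = leftInt σ a v x := by
  rw [leftInt_eq hx, leftInt_eq hx]
  refine integral_congr_ae ?_
  have h' := (ae_restrict_iff' measurableSet_Ioo).1 h
  filter_upwards [h'] with y hy
  by_cases hy' : y ∈ Ioo a b
  · simp [hy', hy hy']
  · simp [hy']

lemma integrableOn_leftInt {a b σ : ℝ} (hσ : 0 < σ) {u : ℝ → ℝ} (hu : IntegrableOn u (Ioo a b)) :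
    IntegrableOn (leftInt σ a u) (Ioo a b) := by
  have h := ((integrable_indicator_iff measurableSet_Ioo).2 hu).integrable_convolution
    (ContinuousLinearMap.mul ℝ ℝ) (integrable_kernel hσ (b - a))
  refine h.integrableOn.congr_fun (fun x hx => ?_) measurableSet_Ioo
  exact (leftInt_eq_convolution (Ioo_subset_Icc_self hx) σ u).symm

/-- Fractional integration by parts. -/
lemma integral_mul_rightInt {a b σ : ℝ} (hσ : 0 < σ) {u ψ : ℝ → ℝ}
    (hu : IntegrableOn u (Ioo a b)) (hψ : Continuous ψ) :
    ∫ x in Ioo a b, u x * rightInt σ b ψ x = ∫ x in Ioo a b, leftInt σ a u x * ψ x := by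
  set U := (Ioo a b).indicator u with hU
  set Ψ := (Ioo a b).indicator ψ with hΨ
  have hUi : Integrable U := (integrable_indicator_iff measurableSet_Ioo).2 hu
  have h1 : ∫ x in Ioo a b, u x * rightInt σ b ψ x
      = ∫ x, ∫ y, U x * kernel σ (b - a) (y - x) * Ψ y := by
    rw [← integral_indicator measurableSet_Ioo]
    congr 1 with x
    by_cases hx : x ∈ Ioo a b
    · rw [indicator_of_mem hx, rightInt_eq (Ioo_subset_Icc_self hx), hU, indicator_of_mem hx,
        ← integral_const_mul]
      congr 1 with y
      ring
    · simp [hU, hx]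
  have h2 : ∫ x in Ioo a b, leftInt σ a u x * ψ x
      = ∫ y, ∫ x, U x * kernel σ (b - a) (y - x) * Ψ y := by
    rw [← integral_indicator measurableSet_Ioo]
    congr 1 with x
    by_cases hx : x ∈ Ioo a b
    · rw [indicator_of_mem hx, leftInt_eq (Ioo_subset_Icc_self hx), hΨ, indicator_of_mem hx,
        ← integral_mul_const]
    · simp [hΨ, hx]
  rw [h1, h2]
  -- Fubini applies: the convolution integrand of `U` and the kernel is integrable on the plane, and
  -- `Ψ` is bounded because ψ is bounded on [a, b].
  obtain ⟨C, hC⟩ := (isCompact_Icc (a := a) (b := b)).exists_bound_of_continuousOn hψ.continuousOn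
  have hi := hUi.convolution_integrand (ContinuousLinearMap.mul ℝ ℝ) (integrable_kernel hσ (b - a))
  have hm : AEStronglyMeasurable (fun p : ℝ × ℝ => Ψ p.1) (volume.prod volume) :=
    ((hψ.measurable.indicator measurableSet_Ioo).comp measurable_fst).aestronglyMeasurable
  have hb : ∀ᵐ p : ℝ × ℝ ∂(volume.prod volume), ‖Ψ p.1‖ ≤ max C 0 := by
    refine ae_of_all _ fun p => ?_
    by_cases hx : p.1 ∈ Ioo a b
    · rw [hΨ, indicator_of_mem hx]
      exact (hC _ (Ioo_subset_Icc_self hx)).trans (le_max_left _ _)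
    · simp [hΨ, hx]
  exact (integral_integral_swap (f := fun y x => U x * kernel σ (b - a) (y - x) * Ψ y)
    (hi.mul_bdd (c := max C 0) hm hb)).symm

/-! ### The semigroup identity and the singular function -/

/-- A rescaled beta integral B(s, 1-s). The two parameters sum to 1, so the scaling power of x is
trivial and Γ(1) = 1 disappears. -/
lemma integral_rpow_mul_sub_rpow {s x : ℝ} (hs : 0 < s) (hs1 : s < 1) (hx : 0 < x) :
    ∫ t in (0 : ℝ)..x, t ^ (s - 1) * (x - t) ^ (1 - s - 1) = Real.Gamma s * Real.Gamma (1 - s) := by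
  have h := Complex.betaIntegral_scaled (s : ℂ) ((1 - s : ℝ) : ℂ) hx
  have hB := Complex.Gamma_mul_Gamma_eq_betaIntegral (s := (s : ℂ)) (t := ((1 - s : ℝ) : ℂ))
    (by simpa using hs) (by simpa using hs1)
  have e : (s : ℂ) + ((1 - s : ℝ) : ℂ) = 1 := by push_cast; ring
  rw [e, Complex.Gamma_one, one_mul] at hB
  rw [e, sub_self, Complex.cpow_zero, one_mul, ← hB, Complex.Gamma_ofReal, Complex.Gamma_ofReal] at h
  have h2 : ∫ t in (0 : ℝ)..x, (t : ℂ) ^ ((s : ℂ) - 1) * ((x : ℂ) - t) ^ (((1 - s : ℝ) : ℂ) - 1)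
      = ∫ t in (0 : ℝ)..x, ((t ^ (s - 1) * (x - t) ^ (1 - s - 1) : ℝ) : ℂ) := by
    refine intervalIntegral.integral_congr fun t ht => ?_
    rw [uIcc_of_le hx.le] at ht
    rw [Complex.ofReal_mul, Complex.ofReal_cpow ht.1, Complex.ofReal_cpow (sub_nonneg.2 ht.2)]
    push_cast
    rfl
  rw [h2, intervalIntegral.integral_ofReal] at h
  exact_mod_cast h

/-- The normalizing Γ factors cancel the beta integral; on (0, L) the product is the kernel of order
1. -/
lemma kernel_convolution {s L x : ℝ} (hs : 0 < s) (hs1 : s < 1) (hx : x ∈ Ioo 0 L) :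
    (kernel s L ⋆[ContinuousLinearMap.mul ℝ ℝ, volume] kernel (1 - s) L) x = 1 := by
  have h := integral_rpow_mul_sub_rpow hs hs1 hx.1
  rw [intervalIntegral.integral_of_le hx.1.le, integral_Ioc_eq_integral_Ioo] at h
  have h1 := (Real.Gamma_pos_of_pos hs).ne'
  have h2 := (Real.Gamma_pos_of_pos (sub_pos.2 hs1)).ne'
  have : (kernel s L ⋆[ContinuousLinearMap.mul ℝ ℝ, volume] kernel (1 - s) L) x
      = ∫ t in Ioo 0 x, (Real.Gamma s)⁻¹ * (Real.Gamma (1 - s))⁻¹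
        * (t ^ (s - 1) * (x - t) ^ (1 - s - 1)) := by
    rw [← integral_indicator measurableSet_Ioo]
    change ∫ t, kernel s L t * kernel (1 - s) L (x - t) = _
    congr 1 with t
    by_cases ht : t ∈ Ioo 0 x
    · rw [indicator_of_mem ht, kernel_of_mem ⟨ht.1, ht.2.trans hx.2⟩,
        kernel_of_mem ⟨by linarith [ht.2], by linarith [ht.1, hx.2]⟩]
      ring
    · rw [indicator_of_notMem ht]
      by_cases h0 : t ∈ Ioo 0 L
      · rw [kernel_of_notMem (t := x - t), mul_zero]
        exact fun h => ht ⟨h0.1, by linarith [h.1]⟩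
      · rw [kernel_of_notMem h0, zero_mul]
  rw [this, integral_const_mul, h]
  field_simp

lemma kernel_convolution_of_nonpos {s r L x : ℝ} (hx : x ≤ 0) :
    (kernel s L ⋆[ContinuousLinearMap.mul ℝ ℝ, volume] kernel r L) x = 0 := by
  change ∫ t, kernel s L t * kernel r L (x - t) = _
  rw [← integral_zero ℝ ℝ]
  congr 1 with t
  by_cases h0 : t ∈ Ioo 0 L
  · rw [kernel_of_notMem (t := x - t), mul_zero]
    exact fun h => by linarith [h.1, h0.1]
  · rw [kernel_of_notMem h0, zero_mul]

/-- The semigroup property in the only case needed: `I^{1-s} I^s = I^1`. -/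
lemma leftInt_leftInt {a b s : ℝ} (hs : 0 < s) (hs1 : s < 1) {u : ℝ → ℝ}
    (hu : IntegrableOn u (Ioo a b)) :
    ∀ᵐ x ∂vol a b, leftInt (1 - s) a (leftInt s a u) x = leftInt 1 a u x := by
  set U := (Ioo a b).indicator u with hU
  have hUi : Integrable U := (integrable_indicator_iff measurableSet_Ioo).2 hu
  have hk := integrable_kernel hs (b - a)
  have hk' := integrable_kernel (sub_pos.2 hs1) (b - a)
  -- Associativity of convolution needs the triple integral of absolute values to be finite, which
  -- is known only for almost every x.
  have hc := (hUi.norm.ae_convolution_exists (ContinuousLinearMap.mul ℝ ℝ)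
    (hk.norm.integrable_convolution (ContinuousLinearMap.mul ℝ ℝ) hk'.norm))
  refine (ae_restrict_iff' measurableSet_Ioo).2 ?_
  filter_upwards [hc] with x hx hxm
  have hassoc := convolution_assoc (ContinuousLinearMap.mul ℝ ℝ) (ContinuousLinearMap.mul ℝ ℝ)
    (ContinuousLinearMap.mul ℝ ℝ) (ContinuousLinearMap.mul ℝ ℝ) (f := U) (ν := volume)
    (μ := volume) (g := kernel s (b - a)) (k := kernel (1 - s) (b - a)) (x₀ := x)
    (fun x y z => mul_assoc x y z) hUi.aestronglyMeasurable hk.aestronglyMeasurable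
    hk'.aestronglyMeasurable
    (hUi.ae_convolution_exists _ hk) (hk.norm.ae_convolution_exists _ hk'.norm) hx
  have hxI := Ioo_subset_Icc_self hxm
  have e1 : leftInt (1 - s) a (leftInt s a u) x
      = ((U ⋆[ContinuousLinearMap.mul ℝ ℝ, volume] kernel s (b - a))
        ⋆[ContinuousLinearMap.mul ℝ ℝ, volume] kernel (1 - s) (b - a)) x := by
    rw [leftInt_eq hxI]
    change _ = ∫ t, (U ⋆[ContinuousLinearMap.mul ℝ ℝ, volume] kernel s (b - a)) t *
      kernel (1 - s) (b - a) (x - t)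
    congr 1 with t
    -- Where the outer kernel is nonzero, t < x < b. Then either t lies in (a, b), or t ≤ a and the
    -- inner convolution vanishes since `U` lives to the right of a.
    by_cases hk0 : x - t ∈ Ioo 0 (b - a)
    · by_cases hta : a < t
      · have htm : t ∈ Ioo a b := ⟨hta, by linarith [hk0.1, hxm.2]⟩
        rw [indicator_of_mem htm, leftInt_eq_convolution (Ioo_subset_Icc_self htm)]
      · rw [indicator_of_notMem fun h => hta h.1]
        have : (U ⋆[ContinuousLinearMap.mul ℝ ℝ, volume] kernel s (b - a)) t = 0 := by
          change ∫ r, U r * kernel s (b - a) (t - r) = 0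
          rw [← integral_zero ℝ ℝ]
          congr 1 with r
          by_cases hr : r ∈ Ioo a b
          · rw [kernel_of_notMem, mul_zero]
            exact fun h => by linarith [h.1, hr.1]
          · rw [hU, indicator_of_notMem hr, zero_mul]
        rw [this]
    · rw [kernel_of_notMem hk0, mul_zero, mul_zero]
  rw [e1, hassoc, leftInt_eq hxI]
  change ∫ t, U t * (kernel s (b - a) ⋆[ContinuousLinearMap.mul ℝ ℝ, volume]
    kernel (1 - s) (b - a)) (x - t) = ∫ t, U t * kernel 1 (b - a) (x - t)
  congr 1 with t
  by_cases ht : t ∈ Ioo a b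
  · rcases le_or_gt (x - t) 0 with h | h
    · rw [kernel_convolution_of_nonpos h, kernel_of_notMem fun h' => absurd h'.1 (not_lt.2 h)]
    · have hm : x - t ∈ Ioo 0 (b - a) := ⟨h, by linarith [ht.1, hxm.2]⟩
      rw [kernel_convolution hs hs1 hm, kernel_of_mem hm]
      simp
  · rw [hU, indicator_of_notMem ht, zero_mul, zero_mul]

/-- The kernel convolution translated by a. Since the result is constant, multiples of this function
have left derivative zero and must appear in the representation. -/
lemma leftInt_kernel {a b s x : ℝ} (hs : 0 < s) (hs1 : s < 1) (hx : x ∈ Ioo a b) :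
    leftInt (1 - s) a (fun y => kernel s (b - a) (y - a)) x = 1 := by
  have hm : x - a ∈ Ioo 0 (b - a) := ⟨by linarith [hx.1], by linarith [hx.2]⟩
  rw [leftInt_eq (Ioo_subset_Icc_self hx)]
  refine Eq.trans ?_ (kernel_convolution hs hs1 hm)
  change _ = ∫ t, kernel s (b - a) t * kernel (1 - s) (b - a) (x - a - t)
  rw [← integral_sub_right_eq_self
    (fun t => kernel s (b - a) t * kernel (1 - s) (b - a) (x - a - t)) a]
  congr 1 with t
  rw [show x - a - (t - a) = x - t by ring]
  by_cases ht : t ∈ Ioo a b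
  · rw [indicator_of_mem ht]
  · rw [indicator_of_notMem ht, kernel_of_notMem (t := t - a)
      fun h => ht ⟨by linarith [h.1], by linarith [h.2]⟩]

/-! ### Continuity and bounds for fractional integrals of L² functions -/

lemma leftInt_one_eq (a x : ℝ) (u : ℝ → ℝ) :
    leftInt 1 a u x = ∫ y in a..x, u y := by
  simp [leftInt]

lemma continuousOn_leftInt_one {a b : ℝ} {u : ℝ → ℝ} (hu : IntegrableOn u (Ioo a b)) :
    ContinuousOn (leftInt 1 a u) (Icc a b) := by
  have := intervalIntegral.continuousOn_primitive_interval (μ := volume) (f := u) (a := a) (b := b)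
  rcases le_or_gt a b with hab | hab
  · rw [uIcc_of_le hab] at this
    refine (this ((integrableOn_Icc_iff_integrableOn_Ioo).2 hu)).congr fun x _ => ?_
    exact leftInt_one_eq a x u
  · simp [Icc_eq_empty (not_le.2 hab)]

/-- Writing the value at x as an inner product with a reflected translate of the kernel gives both
continuity in x and a uniform bound. -/
lemma leftInt_eq_inner {a b σ x : ℝ} (hx : x ∈ Icc a b) (hσ : 1 / 2 < σ) {v : ℝ → ℝ}
    (hv : MemLp ((Ioo a b).indicator v) 2 volume) :
    leftInt σ a v x = inner ℝ (Lp.compMeasurePreserving (fun y => x - y)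
      (Measure.measurePreserving_sub_left volume x) (memLp_kernel hσ (b - a)).toLp) hv.toLp := by
  rw [leftInt_eq hx, L2.inner_def]
  refine integral_congr_ae ?_
  have h := (Measure.measurePreserving_sub_left volume x).quasiMeasurePreserving.ae_eq_comp
    (memLp_kernel hσ (b - a)).coeFn_toLp
  filter_upwards [hv.coeFn_toLp, Lp.coeFn_compMeasurePreserving
    (memLp_kernel hσ (b - a)).toLp (Measure.measurePreserving_sub_left volume x), h]
    with y h1 h2 h3
  rw [h1, h2, h3]
  simp

lemma memLp_indicator {a b : ℝ} {v : ℝ → ℝ} (hv : MemLp v 2 (vol a b)) :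
    MemLp ((Ioo a b).indicator v) 2 volume :=
  (memLp_indicator_iff_restrict measurableSet_Ioo).2 hv

/-- Translation is continuous in L², hence so is the inner product with the moving kernel. -/
lemma continuousOn_leftInt {a b σ : ℝ} (hσ : 1 / 2 < σ) {v : ℝ → ℝ} (hv : MemLp v 2 (vol a b)) :
    ContinuousOn (leftInt σ a v) (Icc a b) := by
  refine ContinuousOn.congr (Continuous.continuousOn ?_)
    fun x hx => leftInt_eq_inner hx hσ (memLp_indicator hv)
  refine Continuous.inner ?_ continuous_const
  let g : ℝ → C(ℝ, ℝ) := fun x => ⟨fun y => x - y, by fun_prop⟩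
  have hg : Continuous g := ContinuousMap.continuous_of_continuous_uncurry _ (by
    change Continuous fun p : ℝ × ℝ => p.1 - p.2
    fun_prop)
  exact Continuous.compMeasurePreservingLp (f := fun _ => (memLp_kernel hσ (b - a)).toLp) (g := g)
    continuous_const hg _ (by simp)

lemma abs_leftInt_le {a b σ x : ℝ} (hx : x ∈ Icc a b) (hσ : 1 / 2 < σ) {v : ℝ → ℝ}
    (hv : MemLp v 2 (vol a b)) :
    |leftInt σ a v x| ≤ ‖(memLp_kernel hσ (b - a)).toLp‖ * ‖hv.toLp‖ := by
  rw [leftInt_eq_inner hx hσ (memLp_indicator hv)]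
  refine (abs_real_inner_le_norm _ _).trans_eq ?_
  rw [Lp.norm_compMeasurePreserving]
  congr 1
  rw [Lp.norm_toLp, Lp.norm_toLp, eLpNorm_indicator_eq_eLpNorm_restrict measurableSet_Ioo]

/-! ### Test functions and the du Bois-Reymond lemma -/

lemma IsTest.deriv {a b : ℝ} {φ : ℝ → ℝ} (h : IsTest a b φ) : IsTest a b (deriv φ) :=
  ⟨(contDiff_infty_iff_deriv.1 h.1).2, h.2.1.deriv, tsupport_deriv_subset.trans h.2.2⟩

lemma IsTest.eq_zero {a b x : ℝ} {φ : ℝ → ℝ} (h : IsTest a b φ) (hx : x ∉ Ioo a b) : φ x = 0 :=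
  image_eq_zero_of_notMem_tsupport fun h' => hx (h.2.2 h')

lemma IsTest.indicator_eq {a b : ℝ} {φ : ℝ → ℝ} (h : IsTest a b φ) :
    (Ioo a b).indicator φ = φ :=
  indicator_eq_self.2 ((subset_tsupport φ).trans h.2.2)

lemma IsTest.rightInt_eq_convolution {a b x σ : ℝ} {φ : ℝ → ℝ} (h : IsTest a b φ)
    (hx : x ∈ Icc a b) : rightInt σ b φ x =
      ((fun t => kernel σ (b - a) (-t)) ⋆[ContinuousLinearMap.mul ℝ ℝ, volume] φ) x := by
  rw [rightInt_eq hx, h.indicator_eq]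
  change _ = ∫ t, kernel σ (b - a) (-t) * φ (x - t)
  rw [← integral_sub_left_eq_self (fun t => kernel σ (b - a) (-t) * φ (x - t)) volume x]
  congr 1 with t
  rw [neg_sub, sub_sub_cancel, mul_comm]

/-- Near a point of (a, b) the right integral is a convolution of φ with a locally integrable
kernel, so the derivative may be moved onto φ. -/
lemma IsTest.rightDeriv_eq {a b x α : ℝ} (hα1 : α < 1) {φ : ℝ → ℝ} (h : IsTest a b φ)
    (hx : x ∈ Ioo a b) : rightDeriv α b φ x = -rightInt (1 - α) b (_root_.deriv φ) x := by
  have hk : LocallyIntegrable (fun t => kernel (1 - α) (b - a) (-t)) volume :=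
    (integrable_kernel (sub_pos.2 hα1) (b - a)).comp_neg.locallyIntegrable
  have hd := h.2.1.hasDerivAt_convolution_right (ContinuousLinearMap.mul ℝ ℝ) hk
    (h.1.of_le (by simp)) x
  rw [rightDeriv, h.deriv.rightInt_eq_convolution (Ioo_subset_Icc_self hx)]
  congr 1
  refine (hd.congr_of_eventuallyEq ?_).deriv
  filter_upwards [isOpen_Ioo.mem_nhds hx] with y hy
  exact h.rightInt_eq_convolution (Ioo_subset_Icc_self hy)

/-- Reduces the fractional weak derivative of u to the ordinary distributional derivative of I^(1-α)
u. -/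
lemma IsTest.integral_mul_rightDeriv {a b α : ℝ} (hα1 : α < 1) {φ u : ℝ → ℝ} (h : IsTest a b φ)
    (hu : IntegrableOn u (Ioo a b)) :
    ∫ x in Ioo a b, u x * rightDeriv α b φ x =
      -∫ x in Ioo a b, leftInt (1 - α) a u x * _root_.deriv φ x := by
  rw [← integral_mul_rightInt (sub_pos.2 hα1) hu h.deriv.1.continuous, ← integral_neg]
  refine setIntegral_congr_fun measurableSet_Ioo fun x hx => ?_
  simp only [h.rightDeriv_eq hα1 hx, mul_neg]

lemma IsTest.integral_mul {a b : ℝ} {φ v : ℝ → ℝ} (h : IsTest a b φ)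
    (hv : IntegrableOn v (Ioo a b)) :
    ∫ x in Ioo a b, v x * φ x = -∫ x in Ioo a b, leftInt 1 a v x * _root_.deriv φ x := by
  rw [← integral_mul_rightInt one_pos hv h.deriv.1.continuous, ← integral_neg]
  refine setIntegral_congr_fun measurableSet_Ioo fun x _ => ?_
  have : rightInt 1 b (_root_.deriv φ) x = -φ x := by
    have h1 : ∫ y in x..b, _root_.deriv φ y = φ b - φ x :=
      intervalIntegral.integral_deriv_eq_sub (fun y _ => (h.1.differentiable (by simp)) y)
        (h.deriv.1.continuous.intervalIntegrable _ _)
    rw [h.eq_zero (fun hb => lt_irrefl b hb.2)] at h1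
    simp [rightInt, h1]
  simp only [this, mul_neg, neg_neg]

lemma IsTest.integrableOn_mul {a b : ℝ} {φ g : ℝ → ℝ} (h : IsTest a b φ)
    (hg : IntegrableOn g (Ioo a b)) : IntegrableOn (fun x => g x * φ x) (Ioo a b) := by
  obtain ⟨C, hC⟩ := h.2.1.exists_bound_of_continuous h.1.continuous
  exact Integrable.mul_bdd (c := C) hg h.1.continuous.aestronglyMeasurable (ae_of_all _ hC)

lemma ae_eq_zero_of_forall_isTest {a b : ℝ} {g : ℝ → ℝ} (hg : LocallyIntegrableOn g (Ioo a b))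
    (h : ∀ φ, IsTest a b φ → ∫ x in Ioo a b, g x * φ x = 0) : g =ᵐ[vol a b] 0 := by
  refine (ae_restrict_iff' measurableSet_Ioo).2
    (isOpen_Ioo.ae_eq_zero_of_integral_contDiff_smul_eq_zero hg fun φ h1 h2 h3 => ?_)
  have ht : IsTest a b φ := ⟨h1, h2, h3⟩
  rw [← h φ ht, ← integral_indicator measurableSet_Ioo]
  congr 1 with x
  by_cases hx : x ∈ Ioo a b
  · rw [indicator_of_mem hx, smul_eq_mul, mul_comm]
  · rw [indicator_of_notMem hx, ht.eq_zero hx, zero_smul]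

lemma IsTest.exists_primitive {a b : ℝ} (hab : a < b) {η : ℝ → ℝ} (h : IsTest a b η)
    (h0 : ∫ x in a..b, η x = 0) : ∃ φ, IsTest a b φ ∧ _root_.deriv φ = η := by
  have hd : ∀ x, HasDerivAt (fun x => ∫ y in a..x, η y) (η x) x := fun x =>
    (h.1.continuous.integral_hasStrictDerivAt a x).hasDerivAt
  have hde : _root_.deriv (fun x => ∫ y in a..x, η y) = η := funext fun x => (hd x).deriv
  refine ⟨fun x => ∫ y in a..x, η y, ?_, hde⟩
  have hcd : ContDiff ℝ ∞ (fun x => ∫ y in a..x, η y) :=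
    contDiff_infty_iff_deriv.2 ⟨fun x => (hd x).differentiableAt, by rw [hde]; exact h.1⟩
  -- The extra point m keeps the compact set nonempty when η = 0, so that it has extreme points p
  -- and q.
  obtain ⟨m, hm⟩ := nonempty_Ioo.2 hab
  have hK : IsCompact (insert m (tsupport η)) := IsCompact.insert h.2.1 m
  have hKs : insert m (tsupport η) ⊆ Ioo a b := insert_subset hm h.2.2
  obtain ⟨p, hp, hpl⟩ := hK.exists_isLeast (insert_nonempty _ _)
  obtain ⟨q, hq, hqg⟩ := hK.exists_isGreatest (insert_nonempty _ _)
  have hz : ∀ x, x ∉ Icc p q → η x = 0 := fun x hx =>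
    image_eq_zero_of_notMem_tsupport fun h' =>
      hx ⟨hpl (mem_insert_of_mem _ h'), hqg (mem_insert_of_mem _ h')⟩
  have hsupp : tsupport (fun x => ∫ y in a..x, η y) ⊆ Icc p q := by
    refine closure_minimal (fun x hx => ?_) isClosed_Icc
    by_contra hxn
    refine hx ?_
    rcases lt_or_ge x p with hlt | hge
    · rw [← intervalIntegral.integral_zero (a := a) (b := x) (μ := volume) (E := ℝ)]
      refine intervalIntegral.integral_congr fun y hy => hz y fun hy' => ?_
      have := hy.2
      have := hy'.1
      have : max a x < p := max_lt (hKs hp).1 hlt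
      linarith
    -- To the right of q the primitive already equals the full integral of η, which is zero.
    · have hqx : q < x := by
        by_contra hc
        exact hxn ⟨hge, not_lt.1 hc⟩
      have e : ∫ y in b..x, η y = 0 := by
        rw [← intervalIntegral.integral_zero (a := b) (b := x) (μ := volume) (E := ℝ)]
        refine intervalIntegral.integral_congr fun y hy => hz y fun hy' => ?_
        have := hy.1
        have := hy'.2
        have : q < min b x := lt_min (hKs hq).2 hqx
        linarith
      have := intervalIntegral.integral_add_adjacent_intervals
        (h.1.continuous.intervalIntegrable (μ := volume) a b)
        (h.1.continuous.intervalIntegrable (μ := volume) b x)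
      simp only
      linarith
  exact ⟨hcd, HasCompactSupport.of_support_subset_isCompact isCompact_Icc
    ((subset_tsupport _).trans hsupp),
    hsupp.trans fun x hx => ⟨(hKs hp).1.trans_le hx.1, hx.2.trans_lt (hKs hq).2⟩⟩

/-- The du Bois-Reymond lemma. -/
lemma ae_eq_const_of_forall_isTest {a b : ℝ} (hab : a < b) {g : ℝ → ℝ}
    (hg : IntegrableOn g (Ioo a b))
    (h : ∀ φ, IsTest a b φ → ∫ x in Ioo a b, g x * deriv φ x = 0) :
    ∃ c, g =ᵐ[vol a b] fun _ => c := by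
  -- The outer radius (b - a)/4 around the midpoint keeps the support inside (a, b).
  let B : ContDiffBump ((a + b) / 2) := ⟨(b - a) / 8, (b - a) / 4, by linarith, by linarith⟩
  set ρ : ℝ → ℝ := B.normed volume with hρdef
  have hρ : IsTest a b ρ := by
    refine ⟨B.contDiff_normed, B.hasCompactSupport_normed, ?_⟩
    rw [hρdef, B.tsupport_normed_eq, Real.closedBall_eq_Icc]
    intro x hx
    have h1 : (a + b) / 2 - (b - a) / 4 ≤ x := hx.1
    have h2 : x ≤ (a + b) / 2 + (b - a) / 4 := hx.2
    constructor <;> linarith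
  have hint : ∀ ψ : ℝ → ℝ, IsTest a b ψ → ∫ x in Ioo a b, ψ x = ∫ x, ψ x := fun ψ hψ => by
    rw [← integral_indicator measurableSet_Ioo, hψ.indicator_eq]
  have hρ1 : ∫ x in Ioo a b, ρ x = 1 := by rw [hint ρ hρ, hρdef, B.integral_normed]
  set c := ∫ x in Ioo a b, g x * ρ x with hc
  refine ⟨c, ?_⟩
  have hconst : IntegrableOn (fun _ : ℝ => c) (Ioo a b) := integrableOn_const (by simp)
  have hz : (fun x => g x - c) =ᵐ[vol a b] 0 := by
    refine ae_eq_zero_of_forall_isTest (hg.sub hconst).locallyIntegrableOn fun ψ hψ => ?_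
    set d := ∫ x in Ioo a b, ψ x with hd
    have hψi : IntegrableOn ψ (Ioo a b) :=
      (hψ.1.continuous.integrable_of_hasCompactSupport hψ.2.1).integrableOn
    have hρi : IntegrableOn ρ (Ioo a b) :=
      (hρ.1.continuous.integrable_of_hasCompactSupport hρ.2.1).integrableOn
    -- Subtracting d ρ makes the integral zero, so the difference is the derivative of a test
    -- function; testing g with it gives ∫ g ψ = c ∫ ψ.
    have hη : IsTest a b (fun x => ψ x - d * ρ x) := by
      refine ⟨hψ.1.sub (contDiff_const.mul hρ.1), hψ.2.1.sub hρ.2.1.mul_left, ?_⟩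
      refine (tsupport_sub ψ (fun x => d * ρ x)).trans (union_subset hψ.2.2 ?_)
      exact (tsupport_mul_subset_right (f := fun _ => d) (g := ρ)).trans hρ.2.2
    obtain ⟨φ, hφ, hφd⟩ := hη.exists_primitive hab (by
      rw [intervalIntegral.integral_of_le hab.le, integral_Ioc_eq_integral_Ioo,
        integral_sub hψi (hρi.const_mul d), integral_const_mul, hρ1, mul_one, sub_self])
    have h1 := h φ hφ
    rw [hφd] at h1
    have e1 : ∫ x in Ioo a b, g x * (ψ x - d * ρ x)
        = (∫ x in Ioo a b, g x * ψ x) - d * c := by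
      rw [hc, ← integral_const_mul, ← integral_sub (hψ.integrableOn_mul hg)
        ((hρ.integrableOn_mul hg).const_mul d)]
      congr 1 with x
      ring
    have e2 : ∫ x in Ioo a b, (g x - c) * ψ x = (∫ x in Ioo a b, g x * ψ x) - c * d := by
      rw [hd, ← integral_const_mul, ← integral_sub (hψ.integrableOn_mul hg) (hψi.const_mul c)]
      congr 1 with x
      ring
    rw [e2, mul_comm c d, ← e1, h1]
  filter_upwards [hz] with x hx
  exact sub_eq_zero.1 hx

/-! ### The representation u = c κ + I^α v -/

lemma leftInt_add_ae {a b σ : ℝ} (hσ : 0 < σ) {u w : ℝ → ℝ} (hu : IntegrableOn u (Ioo a b))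
    (hw : IntegrableOn w (Ioo a b)) : ∀ᵐ x ∂vol a b,
      leftInt σ a (fun y => u y + w y) x = leftInt σ a u x + leftInt σ a w x := by
  refine (ae_restrict_iff' measurableSet_Ioo).2 ?_
  have hk := integrable_kernel hσ (b - a)
  filter_upwards [((integrable_indicator_iff measurableSet_Ioo).2 hu).ae_convolution_exists
    (ContinuousLinearMap.mul ℝ ℝ) hk, ((integrable_indicator_iff measurableSet_Ioo).2
      hw).ae_convolution_exists (ContinuousLinearMap.mul ℝ ℝ) hk] with x h1 h2 hx
  have hx' := Ioo_subset_Icc_self hx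
  rw [leftInt_eq hx', leftInt_eq hx', leftInt_eq hx']
  refine Eq.trans ?_ (integral_add h1 h2)
  congr 1 with y
  by_cases hy : y ∈ Ioo a b <;> simp [hy, add_mul]

lemma leftInt_const_mul (σ a c : ℝ) (u : ℝ → ℝ) (x : ℝ) :
    leftInt σ a (fun y => c * u y) x = c * leftInt σ a u x := by
  simp only [leftInt, mul_left_comm _ c, intervalIntegral.integral_const_mul]

lemma integrableOn_singular {a b α : ℝ} (hα : 0 < α) :
    IntegrableOn (fun x => kernel α (b - a) (x - a)) (Ioo a b) :=
  ((integrable_kernel hα (b - a)).comp_sub_right a).integrableOn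

lemma memLp_integrableOn {a b : ℝ} {u : ℝ → ℝ} (hu : MemLp u 2 (vol a b)) :
    IntegrableOn u (Ioo a b) := hu.integrable (by norm_num)

lemma integrableOn_leftInt_memLp {a b α : ℝ} (hα : 1 / 2 < α) {v : ℝ → ℝ}
    (hv : MemLp v 2 (vol a b)) : IntegrableOn (leftInt α a v) (Ioo a b) :=
  integrableOn_leftInt (by linarith) (memLp_integrableOn hv)

/-- The representation of functions with a left weak derivative in `L²`. -/
theorem IsLeftWeakDeriv.representation {a b α : ℝ} (hab : a < b) (hα : 1 / 2 < α) (hα1 : α < 1)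
    {u v : ℝ → ℝ} (hv : MemLp v 2 (vol a b))
    (h : IsLeftWeakDeriv α a b u v) : ∃ c : ℝ,
      (u =ᵐ[vol a b] fun x => c * kernel α (b - a) (x - a) + leftInt α a v x) ∧
      (leftInt (1 - α) a u =ᵐ[vol a b] fun x => c + leftInt 1 a v x) := by
  have hu := h.1
  have hvi := memLp_integrableOn hv
  have hα0 : 0 < α := by linarith
  have hw := integrableOn_leftInt (sub_pos.2 hα1) hu
  have hV := integrableOn_leftInt one_pos hvi
  -- I^(1-α) u and I^1 v have the same distributional derivative v, hence differ by a constant.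
  obtain ⟨c, hc⟩ := ae_eq_const_of_forall_isTest hab (hw.sub hV) fun φ hφ => by
    have h1 := h.2.2 φ hφ
    rw [hφ.integral_mul_rightDeriv hα1 hu, hφ.integral_mul hvi, neg_inj] at h1
    have h2 := integral_sub (hφ.deriv.integrableOn_mul hw) (hφ.deriv.integrableOn_mul hV)
    rw [h1, sub_self] at h2
    rw [← h2]
    congr 1 with x
    simp only [Pi.sub_apply]
    ring
  have hc' : leftInt (1 - α) a u =ᵐ[vol a b] fun x => c + leftInt 1 a v x := by
    filter_upwards [hc] with x hx
    simp only [Pi.sub_apply] at hx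
    linarith
  refine ⟨c, ?_, hc'⟩
  have hs := (integrableOn_singular (a := a) (b := b) hα0).const_mul c
  have hI := integrableOn_leftInt_memLp hα hv
  set r : ℝ → ℝ := fun x => c * kernel α (b - a) (x - a) + leftInt α a v x with hr
  have hri : IntegrableOn r (Ioo a b) := hs.add hI
  have hz : IntegrableOn (fun x => u x + -1 * r x) (Ioo a b) := hu.add (hri.const_mul (-1))
  -- The candidate r has the same integral of order 1 - α as u: the singular part contributes c, and
  -- I^(1-α) I^α v = I^1 v.
  have h0 : leftInt (1 - α) a (fun x => u x + -1 * r x) =ᵐ[vol a b] fun _ => 0 := by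
    filter_upwards [leftInt_add_ae (sub_pos.2 hα1) hu (hri.const_mul (-1)),
      leftInt_add_ae (sub_pos.2 hα1) hs hI, leftInt_leftInt hα0 hα1 hvi, hc',
      ae_restrict_mem measurableSet_Ioo] with x h1 h2 h3 h4 hx
    rw [h1, leftInt_const_mul, hr, h2, h3, h4, leftInt_const_mul, leftInt_kernel hα0 hα1 hx]
    ring
  -- Applying I^α to I^(1-α)(u - r) = 0 gives I^1 (u - r) = 0, and a function with zero primitive
  -- vanishes almost everywhere.
  have h1 : leftInt 1 a (fun x => u x + -1 * r x) =ᵐ[vol a b] fun _ => 0 := by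
    have h2 := leftInt_leftInt (sub_pos.2 hα1) (by linarith) hz
    rw [sub_sub_cancel] at h2
    filter_upwards [h2, ae_restrict_mem measurableSet_Ioo] with x hx hxm
    rw [← hx, leftInt_congr h0 α (Ioo_subset_Icc_self hxm)]
    simp [leftInt]
  have h2 : (fun x => u x + -1 * r x) =ᵐ[vol a b] 0 := by
    refine ae_eq_zero_of_forall_isTest hz.locallyIntegrableOn fun φ hφ => ?_
    rw [hφ.integral_mul hz, neg_eq_zero, ← integral_zero ℝ ℝ (μ := vol a b)]
    refine integral_congr_ae ?_
    filter_upwards [h1] with x hx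
    rw [hx, zero_mul]
  filter_upwards [h2] with x hx
  simp only [Pi.zero_apply] at hx
  linarith

/-- The coefficient of the singular part is a bounded functional. -/
lemma coeff_eq {a b α c : ℝ} (hab : a < b) (hα1 : α < 1) {u v : ℝ → ℝ}
    (hu : IntegrableOn u (Ioo a b)) (hv : IntegrableOn v (Ioo a b))
    (h : leftInt (1 - α) a u =ᵐ[vol a b] fun x => c + leftInt 1 a v x) :
    c = (b - a)⁻¹ * ((∫ x in Ioo a b, u x * rightInt (1 - α) b (fun _ => 1) x)
      - ∫ x in Ioo a b, v x * rightInt 1 b (fun _ => 1) x) := by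
  -- Integrating I^(1-α) u = c + I^1 v over (a, b) isolates (b - a) c; integration by parts against
  -- 1 moves both integrals onto fixed functions.
  rw [integral_mul_rightInt (sub_pos.2 hα1) hu continuous_const,
    integral_mul_rightInt one_pos hv continuous_const]
  simp only [mul_one]
  have hcst : IntegrableOn (fun _ : ℝ => c) (Ioo a b) := integrableOn_const (by simp)
  rw [integral_congr_ae h, integral_add hcst (integrableOn_leftInt one_pos hv)]
  simp only [integral_const, MeasurableSet.univ, measureReal_restrict_apply, univ_inter,
    Real.volume_real_Ioo_of_le hab.le, smul_eq_mul]
  have : b - a ≠ 0 := by linarith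
  field_simp
  ring

/-! ### Reflection of the interval and pairings in L² -/

lemma rightInt_eq_leftInt (σ a b : ℝ) (u : ℝ → ℝ) (x : ℝ) :
    rightInt σ b u x = leftInt σ a (fun y => u (a + b - y)) (a + b - x) := by
  rw [rightInt, leftInt]
  congr 1
  have := intervalIntegral.integral_comp_sub_left (a := x) (b := b)
    (fun y => (a + b - x - y) ^ (σ - 1) * u (a + b - y)) (a + b)
  rw [show a + b - b = a by ring] at this
  rw [← this]
  congr 1 with y
  rw [show a + b - x - (a + b - y) = y - x by ring, sub_sub_cancel]

lemma leftInt_eq_rightInt (σ a b : ℝ) (u : ℝ → ℝ) (x : ℝ) :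
    leftInt σ a u x = rightInt σ b (fun y => u (a + b - y)) (a + b - x) := by
  rw [rightInt_eq_leftInt σ a b]
  simp only [sub_sub_cancel]

lemma reflect_mem_Ioo {a b x : ℝ} : a + b - x ∈ Ioo a b ↔ x ∈ Ioo a b := by
  constructor <;> rintro ⟨h1, h2⟩ <;> constructor <;> linarith

lemma measurePreserving_reflect (a b : ℝ) :
    MeasurePreserving (fun x => a + b - x) (vol a b) (vol a b) := by
  have h := (Measure.measurePreserving_sub_left volume (a + b)).restrict_preimage
    (measurableSet_Ioo (a := a) (b := b))
  have e : (fun x => a + b - x) ⁻¹' Ioo a b = Ioo a b := by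
    ext x
    exact reflect_mem_Ioo
  rwa [e] at h

lemma integral_reflect (a b : ℝ) (F : ℝ → ℝ) :
    ∫ x in Ioo a b, F (a + b - x) = ∫ x in Ioo a b, F x :=
  (measurePreserving_reflect a b).integral_comp
    (Homeomorph.subLeft (a + b)).measurableEmbedding F

/-- Bounded by sup |ψ| times the mass of the kernel. Such functions then define continuous
functionals on L², both for the graph condition and for the singular coefficient. -/
lemma memLp_rightInt {a b σ : ℝ} (hσ : 0 < σ) {ψ : ℝ → ℝ} (hψ : Continuous ψ) :
    MemLp (rightInt σ b ψ) 2 (vol a b) := by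
  obtain ⟨C, hC⟩ := (isCompact_Icc (a := a) (b := b)).exists_bound_of_continuousOn hψ.continuousOn
  have hmeas : AEStronglyMeasurable (rightInt σ b ψ) (vol a b) := by
    have h1 : IntegrableOn (fun y => ψ (a + b - y)) (Ioo a b) :=
      (hψ.comp (continuous_const.sub continuous_id)).continuousOn.integrableOn_Icc.mono_set
        Ioo_subset_Icc_self
    have h2 := (integrableOn_leftInt hσ h1).aestronglyMeasurable.comp_measurePreserving
      (measurePreserving_reflect a b)
    exact h2.congr (ae_of_all _ fun x => (rightInt_eq_leftInt σ a b ψ x).symm)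
  refine MemLp.of_bound hmeas (max C 0 * ∫ t, kernel σ (b - a) t) ?_
  refine (ae_restrict_iff' measurableSet_Ioo).2 (ae_of_all _ fun x hx => ?_)
  rw [rightInt_eq (Ioo_subset_Icc_self hx), ← integral_sub_right_eq_self (kernel σ (b - a)) x,
    ← integral_const_mul]
  refine norm_integral_le_of_norm_le
    (((integrable_kernel hσ (b - a)).comp_sub_right x).const_mul _) (ae_of_all _ fun y => ?_)
  rw [norm_mul, Real.norm_of_nonneg (kernel_nonneg hσ _ _)]
  refine mul_le_mul_of_nonneg_right ?_ (kernel_nonneg hσ _ _)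
  by_cases hy : y ∈ Ioo a b
  · rw [indicator_of_mem hy]
    exact (hC y (Ioo_subset_Icc_self hy)).trans (le_max_left _ _)
  · simp [hy]

lemma IsTest.memLp {a b : ℝ} {φ : ℝ → ℝ} (h : IsTest a b φ) : MemLp φ 2 (vol a b) :=
  (h.1.continuous.memLp_of_hasCompactSupport h.2.1).restrict _

lemma IsTest.memLp_rightDeriv {a b α : ℝ} (hα1 : α < 1) {φ : ℝ → ℝ} (h : IsTest a b φ) :
    MemLp (rightDeriv α b φ) 2 (vol a b) := by
  refine (memLp_rightInt (sub_pos.2 hα1) h.deriv.1.continuous).neg.ae_eq ?_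
  refine (ae_restrict_iff' measurableSet_Ioo).2 (ae_of_all _ fun x hx => ?_)
  exact (h.rightDeriv_eq hα1 hx).symm

/-- Pairing with a fixed square integrable function. -/
noncomputable def pairing {a b : ℝ} {ψ : ℝ → ℝ} (h : MemLp ψ 2 (vol a b)) : L2 a b →L[ℝ] ℝ :=
  innerSL ℝ h.toLp

lemma pairing_apply {a b : ℝ} {ψ : ℝ → ℝ} (h : MemLp ψ 2 (vol a b)) (u : L2 a b) :
    pairing h u = ∫ x in Ioo a b, u x * ψ x := by
  rw [pairing, innerSL_apply_apply, L2.inner_def]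
  refine integral_congr_ae ?_
  filter_upwards [h.coeFn_toLp] with x hx
  simp [hx]

/-! ### Closed graph, singular coefficient and trace -/

/-- A closed graph description of a one-sided weak derivative `D` with domain `H`, together with
bounded functionals on the graph describing the singular coefficient and the trace, and the
Poincaré inequality for functions without singular part. The predicate `Opp` is the vanishing of the
trace at the singular endpoint. -/
structure OneSidedCalculus (a b : ℝ) (H : Set (L2 a b)) (D : L2 a b → ℝ → ℝ)
    (Coef Tr Opp : L2 a b → Prop) where
  graph : Submodule ℝ (L2 a b × L2 a b)
  isClosed_graph : IsClosed (graph : Set (L2 a b × L2 a b))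
  mem_iff : ∀ u, u ∈ H ↔ ∃ v, (u, v) ∈ graph
  deriv_ae_eq : ∀ u v, (u, v) ∈ graph → D u =ᵐ[vol a b] v
  coef : L2 a b × L2 a b →L[ℝ] ℝ
  tr : L2 a b × L2 a b →L[ℝ] ℝ
  coef_iff : ∀ u v, (u, v) ∈ graph → (Coef u ↔ coef (u, v) = 0)
  tr_iff : ∀ u v, (u, v) ∈ graph → (Tr u ↔ tr (u, v) = 0)
  const : ℝ
  const_nonneg : 0 ≤ const
  poincare : ∀ u v, (u, v) ∈ graph → coef (u, v) = 0 → ‖u‖ ≤ const * ‖v‖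
  coef_of_opp : ∀ u v, (u, v) ∈ graph → Opp u → coef (u, v) = 0

lemma isLeftWeakDeriv_iff {a b α : ℝ} {u v : ℝ → ℝ} (hu : MemLp u 2 (vol a b))
    (hv : MemLp v 2 (vol a b)) : IsLeftWeakDeriv α a b u v ↔ ∀ φ, IsTest a b φ →
      ∫ x in Ioo a b, v x * φ x = ∫ x in Ioo a b, u x * rightDeriv α b φ x :=
  ⟨fun h => h.2.2,
    fun h => ⟨memLp_integrableOn hu, (memLp_integrableOn hv).locallyIntegrableOn, h⟩⟩

lemma isRightWeakDeriv_iff {a b α : ℝ} {u v : ℝ → ℝ} (hu : MemLp u 2 (vol a b))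
    (hv : MemLp v 2 (vol a b)) : IsRightWeakDeriv α a b u v ↔ ∀ φ, IsTest a b φ →
      ∫ x in Ioo a b, v x * φ x = ∫ x in Ioo a b, u x * leftDeriv α a φ x :=
  ⟨fun h => h.2.2,
    fun h => ⟨memLp_integrableOn hu, (memLp_integrableOn hv).locallyIntegrableOn, h⟩⟩

/-- Only local integrability is available, since the derivative selected by choice need not be the
square integrable one; products with a test function are integrable because they live on its compact
support. -/
lemma ae_eq_of_forall_isTest {a b : ℝ} {v w : ℝ → ℝ} (hv : LocallyIntegrableOn v (Ioo a b))
    (hw : LocallyIntegrableOn w (Ioo a b))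
    (h : ∀ φ, IsTest a b φ → ∫ x in Ioo a b, v x * φ x = ∫ x in Ioo a b, w x * φ x) :
    v =ᵐ[vol a b] w := by
  have hmul : ∀ {g φ : ℝ → ℝ}, LocallyIntegrableOn g (Ioo a b) → IsTest a b φ →
      IntegrableOn (fun x => g x * φ x) (Ioo a b) := by
    intro g φ hg hφ
    have h1 : IntegrableOn g (tsupport φ) := hg.integrableOn_compact_subset hφ.2.2 hφ.2.1
    obtain ⟨C, hC⟩ := hφ.2.1.exists_bound_of_continuous hφ.1.continuous
    have h2 : IntegrableOn (fun x => g x * φ x) (tsupport φ) :=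
      Integrable.mul_bdd (c := C) h1 hφ.1.continuous.aestronglyMeasurable (ae_of_all _ hC)
    refine (IntegrableOn.integrable_of_forall_notMem_eq_zero h2 fun x hx => ?_).integrableOn
    rw [image_eq_zero_of_notMem_tsupport hx, mul_zero]
  have hz : (fun x => v x - w x) =ᵐ[vol a b] 0 := by
    refine ae_eq_zero_of_forall_isTest (hv.sub hw) fun φ hφ => ?_
    simp only [sub_mul]
    rw [integral_sub (hmul hv hφ) (hmul hw hφ), h φ hφ, sub_self]
  filter_upwards [hz] with x hx
  exact sub_eq_zero.1 hx

lemma leftWeakDeriv_ae_eq {a b α : ℝ} {u v : ℝ → ℝ} (h : IsLeftWeakDeriv α a b u v) :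
    leftWeakDeriv α a b u =ᵐ[vol a b] v := by
  have hex : ∃ v, IsLeftWeakDeriv α a b u v := ⟨v, h⟩
  rw [leftWeakDeriv, dif_pos hex]
  have hs := hex.choose_spec
  exact ae_eq_of_forall_isTest hs.2.1 h.2.1 fun φ hφ => (hs.2.2 φ hφ).trans (h.2.2 φ hφ).symm

lemma rightWeakDeriv_ae_eq {a b α : ℝ} {u v : ℝ → ℝ} (h : IsRightWeakDeriv α a b u v) :
    rightWeakDeriv α a b u =ᵐ[vol a b] v := by
  have hex : ∃ v, IsRightWeakDeriv α a b u v := ⟨v, h⟩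
  rw [rightWeakDeriv, dif_pos hex]
  have hs := hex.choose_spec
  exact ae_eq_of_forall_isTest hs.2.1 h.2.1 fun φ hφ => (hs.2.2 φ hφ).trans (h.2.2 φ hφ).symm

lemma IsLeftWeakDeriv.congr_right {a b α : ℝ} {u v w : ℝ → ℝ} (h : IsLeftWeakDeriv α a b u v)
    (hvw : v =ᵐ[vol a b] w) (hw : LocallyIntegrableOn w (Ioo a b)) :
    IsLeftWeakDeriv α a b u w := by
  refine ⟨h.1, hw, fun φ hφ => (integral_congr_ae ?_).trans (h.2.2 φ hφ)⟩
  filter_upwards [hvw] with x hx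
  rw [hx]

lemma IsRightWeakDeriv.congr_right {a b α : ℝ} {u v w : ℝ → ℝ} (h : IsRightWeakDeriv α a b u v)
    (hvw : v =ᵐ[vol a b] w) (hw : LocallyIntegrableOn w (Ioo a b)) :
    IsRightWeakDeriv α a b u w := by
  refine ⟨h.1, hw, fun φ hφ => (integral_congr_ae ?_).trans (h.2.2 φ hφ)⟩
  filter_upwards [hvw] with x hx
  rw [hx]

lemma mem_leftH_iff {a b α : ℝ} (u : L2 a b) :
    u ∈ leftH α a b ↔ ∃ v : L2 a b, IsLeftWeakDeriv α a b u v := by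
  constructor
  · rintro ⟨v, hv, hm⟩
    exact ⟨hm.toLp, hv.congr_right hm.coeFn_toLp.symm
      (memLp_integrableOn (Lp.memLp hm.toLp)).locallyIntegrableOn⟩
  · rintro ⟨v, hv⟩
    exact ⟨v, hv, Lp.memLp v⟩

lemma mem_rightH_iff {a b α : ℝ} (u : L2 a b) :
    u ∈ rightH α a b ↔ ∃ v : L2 a b, IsRightWeakDeriv α a b u v := by
  constructor
  · rintro ⟨v, hv, hm⟩
    exact ⟨hm.toLp, hv.congr_right hm.coeFn_toLp.symm
      (memLp_integrableOn (Lp.memLp hm.toLp)).locallyIntegrableOn⟩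
  · rintro ⟨v, hv⟩
    exact ⟨v, hv, Lp.memLp v⟩

/-- The graph of the left weak derivative in `L²`. -/
noncomputable def leftGraph {α : ℝ} (hα1 : α < 1) (a b : ℝ) : Submodule ℝ (L2 a b × L2 a b) :=
  ⨅ φ : {φ : ℝ → ℝ // IsTest a b φ},
    (pairing φ.2.memLp ∘L ContinuousLinearMap.snd ℝ (L2 a b) (L2 a b)
      - pairing (φ.2.memLp_rightDeriv hα1) ∘L ContinuousLinearMap.fst ℝ (L2 a b) (L2 a b)).ker

lemma mem_leftGraph {a b α : ℝ} (hα1 : α < 1) (u v : L2 a b) :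
    (u, v) ∈ leftGraph hα1 a b ↔ IsLeftWeakDeriv α a b u v := by
  rw [isLeftWeakDeriv_iff (Lp.memLp u) (Lp.memLp v)]
  simp [leftGraph, Submodule.mem_iInf, sub_eq_zero, pairing_apply]

lemma isClosed_leftGraph {α : ℝ} (hα1 : α < 1) (a b : ℝ) :
    IsClosed (leftGraph hα1 a b : Set (L2 a b × L2 a b)) := by
  rw [leftGraph, Submodule.coe_iInf]
  exact isClosed_iInter fun φ => ContinuousLinearMap.isClosed_ker _

lemma continuousOn_singular (a b α : ℝ) (c : ℝ) :
    ContinuousOn (fun x => c * ((Real.Gamma α)⁻¹ * (x - a) ^ (α - 1))) (Ioc a b) := by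
  refine continuousOn_const.mul (continuousOn_const.mul ?_)
  refine ContinuousOn.rpow_const (by fun_prop) fun x hx => Or.inl ?_
  have := hx.1
  linarith

/-- Continuous functions that agree almost everywhere agree at the endpoint too, and I^1 v vanishes
at a. -/
lemma hasLeftCoeff_iff {a b c d : ℝ} {α : ℝ} (hab : a < b) {u v : ℝ → ℝ}
    (hv : IntegrableOn v (Ioo a b))
    (h : leftInt (1 - α) a u =ᵐ[vol a b] fun x => c + leftInt 1 a v x) :
    HasLeftCoeff α a b u d ↔ c = d := by
  have hc : ContinuousOn (fun x => c + leftInt 1 a v x) (Icc a b) :=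
    continuousOn_const.add (continuousOn_leftInt_one hv)
  have ha : c + leftInt 1 a v a = c := by simp [leftInt]
  constructor
  · rintro ⟨g, hg, hug, hga⟩
    have hae : (fun x => c + leftInt 1 a v x) =ᵐ[volume.restrict (Icc a b)] g := by
      rw [← Measure.restrict_congr_set Ioo_ae_eq_Icc]
      exact h.symm.trans hug
    have := Measure.eqOn_Icc_of_ae_eq volume hab.ne hae hc hg (left_mem_Icc.2 hab.le)
    simp only [ha] at this
    rw [this, hga]
  · rintro rfl
    exact ⟨_, hc, h, ha⟩

lemma hasLeftTrace_iff {a b d : ℝ} (hab : a < b) {u r : ℝ → ℝ} (hr : ContinuousOn r (Ioc a b))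
    (h : u =ᵐ[vol a b] r) : HasLeftTrace a b u d ↔ r b = d := by
  constructor
  · rintro ⟨g, hg, hug, hga⟩
    have hae : r =ᵐ[volume.restrict (Ioc a b)] g := by
      rw [← Measure.restrict_congr_set Ioo_ae_eq_Ioc]
      exact h.symm.trans hug
    rw [← hga]
    exact Measure.eqOn_Ioc_of_ae_eq volume hae hr hg (right_mem_Ioc.2 hab)
  · intro hd
    exact ⟨r, hr, h, hd⟩

/-- Both the representative g and the regular part w have finite limits at a. If c were nonzero,
solving for (x - a)^(α-1) would give it a finite limit, yet it tends to infinity. The value of the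
trace plays no role. -/
lemma coeff_eq_zero_of_hasRightTrace {a b c d α : ℝ} (hab : a < b) (hα0 : 0 < α) (hα1 : α < 1)
    {u w : ℝ → ℝ} (hw : ContinuousOn w (Icc a b))
    (h : u =ᵐ[vol a b] fun x => c * ((Real.Gamma α)⁻¹ * (x - a) ^ (α - 1)) + w x)
    (ht : HasRightTrace a b u d) : c = 0 := by
  obtain ⟨g, hg, hug, -⟩ := ht
  by_contra hc
  have hΓ := (Real.Gamma_pos_of_pos hα0).ne'
  have heq := Measure.eqOn_Ioo_of_ae_eq volume (h.symm.trans hug)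
    (((continuousOn_singular a b α c).mono Ioo_subset_Ioc_self).add (hw.mono Ioo_subset_Icc_self))
    (hg.mono Ioo_subset_Ico_self)
  have h1 : Tendsto g (𝓝[>] a) (𝓝 (g a)) := by
    rw [← nhdsWithin_Ioo_eq_nhdsGT hab]
    exact (hg a (left_mem_Ico.2 hab)).mono Ioo_subset_Ico_self
  have h2 : Tendsto w (𝓝[>] a) (𝓝 (w a)) := by
    rw [← nhdsWithin_Ioo_eq_nhdsGT hab]
    exact (hw a (left_mem_Icc.2 hab.le)).mono Ioo_subset_Icc_self
  have h3 : Tendsto (fun x : ℝ => x - a) (𝓝[>] a) (𝓝[>] 0) := by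
    refine tendsto_nhdsWithin_iff.2 ⟨?_, ?_⟩
    · have : Tendsto (fun x : ℝ => x - a) (𝓝 a) (𝓝 (a - a)) := by
        exact (continuous_id.sub continuous_const).tendsto a
      rw [sub_self] at this
      exact this.mono_left nhdsWithin_le_nhds
    · filter_upwards [self_mem_nhdsWithin] with x hx
      exact sub_pos.2 (mem_Ioi.1 hx)
  have h4 : Tendsto (fun x : ℝ => (x - a) ^ (α - 1)) (𝓝[>] a) atTop :=
    (tendsto_rpow_neg_nhdsGT_zero (by linarith)).comp h3
  refine not_tendsto_nhds_of_tendsto_atTop h4 (c⁻¹ * Real.Gamma α * (g a - w a)) ?_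
  refine ((h1.sub h2).const_mul (c⁻¹ * Real.Gamma α)).congr' ?_
  filter_upwards [Ioo_mem_nhdsGT hab] with x hx
  rw [← heq hx]
  field_simp
  ring

lemma leftInt_right_eq {a b α : ℝ} (hab : a < b) (v : ℝ → ℝ) :
    leftInt α a v b = ∫ x in Ioo a b, v x * kernel α (b - a) (b - x) := by
  rw [leftInt_eq (right_mem_Icc.2 hab.le), ← integral_indicator measurableSet_Ioo]
  congr 1 with x
  by_cases hx : x ∈ Ioo a b <;> simp [hx]

lemma memLp_kernel_sub {α : ℝ} (hα : 1 / 2 < α) (a b : ℝ) :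
    MemLp (fun x => kernel α (b - a) (b - x)) 2 (vol a b) :=
  ((memLp_kernel hα (b - a)).comp_measurePreserving
    (Measure.measurePreserving_sub_left volume b)).restrict _

/-- The functional `c` in `u = c κ + I^α v`. -/
noncomputable def coefCLM {α : ℝ} (hα1 : α < 1) (a b : ℝ) : L2 a b × L2 a b →L[ℝ] ℝ :=
  (b - a)⁻¹ • (pairing (memLp_rightInt (a := a) (b := b) (sub_pos.2 hα1)
      (continuous_const (y := (1 : ℝ)))) ∘L ContinuousLinearMap.fst ℝ (L2 a b) (L2 a b)
    - pairing (memLp_rightInt (a := a) (b := b) one_pos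
      (continuous_const (y := (1 : ℝ)))) ∘L ContinuousLinearMap.snd ℝ (L2 a b) (L2 a b))

/-- The trace at `b` as a functional on the graph. -/
noncomputable def traceCLM {α : ℝ} (hα : 1 / 2 < α) (hα1 : α < 1) (a b : ℝ) :
    L2 a b × L2 a b →L[ℝ] ℝ :=
  ((Real.Gamma α)⁻¹ * (b - a) ^ (α - 1)) • coefCLM hα1 a b
    + pairing (memLp_kernel_sub hα a b) ∘L ContinuousLinearMap.snd ℝ (L2 a b) (L2 a b)

lemma representation_graph {a b α : ℝ} (hab : a < b) (hα : 1 / 2 < α) (hα1 : α < 1) {u v : L2 a b}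
    (h : (u, v) ∈ leftGraph hα1 a b) :
    (u =ᵐ[vol a b] fun x => coefCLM hα1 a b (u, v) * ((Real.Gamma α)⁻¹ * (x - a) ^ (α - 1))
        + leftInt α a v x) ∧
      (leftInt (1 - α) a u =ᵐ[vol a b] fun x => coefCLM hα1 a b (u, v) + leftInt 1 a v x) := by
  obtain ⟨c, h1, h2⟩ := ((mem_leftGraph hα1 u v).1 h).representation hab hα hα1 (Lp.memLp v)
  have hc : coefCLM hα1 a b (u, v) = c := by
    rw [coeff_eq hab hα1 (memLp_integrableOn (Lp.memLp u)) (memLp_integrableOn (Lp.memLp v)) h2]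
    simp [coefCLM, pairing_apply]
  rw [hc]
  refine ⟨?_, h2⟩
  filter_upwards [h1, ae_restrict_mem measurableSet_Ioo] with x hx hm
  rw [hx, kernel_of_mem ⟨by linarith [hm.1], by linarith [hm.2]⟩]

/-- The left calculus. -/
noncomputable def leftCalculus {a b α : ℝ} (hab : a < b) (hα : 1 / 2 < α) (hα1 : α < 1) :
    OneSidedCalculus a b (leftH α a b) (fun u => leftWeakDeriv α a b u)
      (fun u => HasLeftCoeff α a b u 0) (fun u => HasLeftTrace a b u 0)
      (fun u => HasRightTrace a b u 0) where
  graph := leftGraph hα1 a b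
  isClosed_graph := isClosed_leftGraph hα1 a b
  mem_iff u := by simp only [mem_leftH_iff, mem_leftGraph]
  deriv_ae_eq u v h := leftWeakDeriv_ae_eq ((mem_leftGraph hα1 u v).1 h)
  coef := coefCLM hα1 a b
  tr := traceCLM hα hα1 a b
  coef_iff u v h := hasLeftCoeff_iff hab (memLp_integrableOn (Lp.memLp v))
    (representation_graph hab hα hα1 h).2
  tr_iff u v h := by
    have hc := ((continuousOn_singular a b α (coefCLM hα1 a b (u, v))).add
      ((continuousOn_leftInt hα (Lp.memLp v)).mono Ioc_subset_Icc_self))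
    refine (hasLeftTrace_iff hab hc (representation_graph hab hα hα1 h).1).trans ?_
    simp only [Pi.add_apply, traceCLM, leftInt_right_eq hab, add_apply,
      smul_apply, ContinuousLinearMap.comp_apply,
      ContinuousLinearMap.coe_snd', pairing_apply, smul_eq_mul]
    rw [mul_comm]
  -- The square root of b - a turns the uniform bound on I^α v into an L² bound; the kernel norm
  -- comes from Cauchy-Schwarz.
  const := measureUnivNNReal (vol a b) ^ (2 : ENNReal).toReal⁻¹ *
    ‖(memLp_kernel hα (b - a)).toLp‖
  const_nonneg := by positivity
  poincare u v h h0 := by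
    rw [mul_assoc]
    refine Lp.norm_le_of_ae_bound (by positivity) ?_
    filter_upwards [(representation_graph hab hα hα1 h).1, ae_restrict_mem measurableSet_Ioo]
      with x hx hm
    rw [hx, h0, zero_mul, zero_add]
    refine (abs_leftInt_le (Ioo_subset_Icc_self hm) hα (Lp.memLp v)).trans_eq ?_
    rw [Lp.toLp_coeFn]
  coef_of_opp u v h h0 := coeff_eq_zero_of_hasRightTrace hab (by linarith) hα1
    (continuousOn_leftInt hα (Lp.memLp v)) (representation_graph hab hα hα1 h).1 h0

/-! ### The right-sided theory by reflection -/

/-- Reflection of `(a, b)` as an isometry of `L²`. -/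
noncomputable def reflect (a b : ℝ) : L2 a b →L[ℝ] L2 a b :=
  (Lp.compMeasurePreservingₗᵢ ℝ _ (measurePreserving_reflect a b)).toContinuousLinearMap

lemma coeFn_reflect {a b : ℝ} (u : L2 a b) :
    reflect a b u =ᵐ[vol a b] fun x => u (a + b - x) :=
  Lp.coeFn_compMeasurePreserving u (measurePreserving_reflect a b)

lemma norm_reflect {a b : ℝ} (u : L2 a b) : ‖reflect a b u‖ = ‖u‖ :=
  Lp.norm_compMeasurePreserving u (measurePreserving_reflect a b)

lemma ae_comp_reflect {a b : ℝ} {u v : ℝ → ℝ} (h : u =ᵐ[vol a b] v) :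
    (fun x => u (a + b - x)) =ᵐ[vol a b] fun x => v (a + b - x) :=
  (measurePreserving_reflect a b).quasiMeasurePreserving.ae_eq_comp h

lemma reflect_reflect {a b : ℝ} (u : L2 a b) : reflect a b (reflect a b u) = u := by
  refine Lp.ext ?_
  filter_upwards [coeFn_reflect (reflect a b u), ae_comp_reflect (coeFn_reflect u)] with x h1 h2
  rw [h1, h2, sub_sub_cancel]

lemma integral_reflect_mul {a b : ℝ} (u : L2 a b) (ψ : ℝ → ℝ) :
    ∫ x in Ioo a b, reflect a b u x * ψ x = ∫ x in Ioo a b, u x * ψ (a + b - x) := by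
  rw [← integral_reflect a b (fun x => u x * ψ (a + b - x))]
  refine integral_congr_ae ?_
  filter_upwards [coeFn_reflect u] with x hx
  rw [hx, sub_sub_cancel]

lemma IsTest.reflect {a b : ℝ} {φ : ℝ → ℝ} (h : IsTest a b φ) :
    IsTest a b fun x => φ (a + b - x) := by
  have hc : HasCompactSupport fun x => φ (a + b - x) :=
    h.2.1.comp_homeomorph (Homeomorph.subLeft (a + b))
  refine ⟨h.1.comp (contDiff_const.sub contDiff_id), hc, fun x hx => ?_⟩
  have := tsupport_comp_subset_preimage φ (f := fun x => a + b - x) (by fun_prop) hx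
  exact reflect_mem_Ioo.1 (h.2.2 this)

lemma rightDeriv_reflect (α a b : ℝ) (φ : ℝ → ℝ) (x : ℝ) :
    rightDeriv α b (fun y => φ (a + b - y)) x = leftDeriv α a φ (a + b - x) := by
  have : rightInt (1 - α) b (fun y => φ (a + b - y)) =
      fun x => leftInt (1 - α) a φ (a + b - x) :=
    funext fun x => by rw [leftInt_eq_rightInt _ a b, sub_sub_cancel]
  rw [rightDeriv, leftDeriv, this, deriv_comp_const_sub, neg_neg]

/-- Reflection permutes the test functions and exchanges the two classical derivatives without a
sign, the minus in the right derivative absorbing the chain rule. -/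
lemma isRightWeakDeriv_iff_reflect {a b α : ℝ} (u v : L2 a b) :
    IsRightWeakDeriv α a b u v ↔ IsLeftWeakDeriv α a b (reflect a b u) (reflect a b v) := by
  rw [isRightWeakDeriv_iff (Lp.memLp u) (Lp.memLp v), isLeftWeakDeriv_iff (Lp.memLp _) (Lp.memLp _)]
  have key : ∀ φ : ℝ → ℝ, (∫ x in Ioo a b, u x * rightDeriv α b φ (a + b - x))
      = ∫ x in Ioo a b, u x * leftDeriv α a (fun y => φ (a + b - y)) x := by
    intro φ
    congr 1 with x
    have := rightDeriv_reflect α a b (fun y => φ (a + b - y)) (a + b - x)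
    simp only [sub_sub_cancel] at this
    rw [this]
  constructor
  · intro h φ hφ
    rw [integral_reflect_mul, integral_reflect_mul, h _ hφ.reflect, key]
  · intro h φ hφ
    have := h _ hφ.reflect
    rw [integral_reflect_mul, integral_reflect_mul, key] at this
    simpa only [sub_sub_cancel] using this

lemma continuousOn_comp_reflect {a b : ℝ} {g : ℝ → ℝ} {s t : Set ℝ} (hg : ContinuousOn g s)
    (h : MapsTo (fun x => a + b - x) t s) : ContinuousOn (fun x => g (a + b - x)) t :=
  hg.comp (by fun_prop) h

lemma HasLeftTrace.reflect {a b c : ℝ} {u : L2 a b} (h : HasLeftTrace a b u c) :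
    HasRightTrace a b (reflect a b u) c := by
  obtain ⟨g, h1, h2, h3⟩ := h
  refine ⟨fun x => g (a + b - x), continuousOn_comp_reflect h1 fun x hx => ?_,
    (coeFn_reflect u).trans (ae_comp_reflect h2), by simpa using h3⟩
  exact ⟨by linarith [hx.2], by linarith [hx.1]⟩

lemma HasRightTrace.reflect {a b c : ℝ} {u : L2 a b} (h : HasRightTrace a b u c) :
    HasLeftTrace a b (reflect a b u) c := by
  obtain ⟨g, h1, h2, h3⟩ := h
  refine ⟨fun x => g (a + b - x), continuousOn_comp_reflect h1 fun x hx => ?_,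
    (coeFn_reflect u).trans (ae_comp_reflect h2), by simpa using h3⟩
  exact ⟨by linarith [hx.2], by linarith [hx.1]⟩

lemma rightInt_ae_eq_reflect {a b : ℝ} (σ : ℝ) (u : L2 a b) :
    rightInt σ b u =ᵐ[vol a b] fun x => leftInt σ a (reflect a b u) (a + b - x) := by
  filter_upwards [ae_restrict_mem measurableSet_Ioo] with x hx
  rw [rightInt_eq_leftInt σ a b]
  exact leftInt_congr (coeFn_reflect u).symm σ (Ioo_subset_Icc_self (reflect_mem_Ioo.2 hx))

lemma hasRightCoeff_iff_reflect {a b c α : ℝ} (u : L2 a b) :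
    HasRightCoeff α a b u c ↔ HasLeftCoeff α a b (reflect a b u) c := by
  have hm : MapsTo (fun x => a + b - x) (Icc a b) (Icc a b) := fun x hx =>
    ⟨by linarith [hx.2], by linarith [hx.1]⟩
  have hr := rightInt_ae_eq_reflect (1 - α) u
  constructor
  · rintro ⟨g, h1, h2, h3⟩
    refine ⟨fun x => g (a + b - x), continuousOn_comp_reflect h1 hm, ?_, by simpa using h3⟩
    simpa only [sub_sub_cancel] using ae_comp_reflect (hr.symm.trans h2)
  · rintro ⟨g, h1, h2, h3⟩
    exact ⟨fun x => g (a + b - x), continuousOn_comp_reflect h1 hm,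
      hr.trans (ae_comp_reflect h2), by simpa using h3⟩

/-- The right calculus, obtained from the left one by reflection. -/
noncomputable def rightCalculus {a b α : ℝ} (hab : a < b) (hα : 1 / 2 < α) (hα1 : α < 1) :
    OneSidedCalculus a b (rightH α a b) (fun u => rightWeakDeriv α a b u)
      (fun u => HasRightCoeff α a b u 0) (fun u => HasRightTrace a b u 0)
      (fun u => HasLeftTrace a b u 0) :=
  have hmem : ∀ u v : L2 a b, (reflect a b u, reflect a b v) ∈ (leftCalculus hab hα hα1).graph ↔
      IsRightWeakDeriv α a b u v := fun u v =>
    (mem_leftGraph hα1 _ _).trans (isRightWeakDeriv_iff_reflect u v).symm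
  let R := (reflect a b).prodMap (reflect a b)
  { graph := (leftCalculus hab hα hα1).graph.comap R.toLinearMap
    isClosed_graph := (leftCalculus hab hα hα1).isClosed_graph.preimage R.continuous
    mem_iff := fun u => (mem_rightH_iff u).trans (exists_congr fun v => (hmem u v).symm)
    deriv_ae_eq := fun u v h => rightWeakDeriv_ae_eq ((hmem u v).1 h)
    coef := (leftCalculus hab hα hα1).coef ∘L R
    tr := (leftCalculus hab hα hα1).tr ∘L R
    coef_iff := fun u v h => (hasRightCoeff_iff_reflect u).trans
      ((leftCalculus hab hα hα1).coef_iff _ _ h)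
    tr_iff := fun u v h => by
      refine Iff.trans ⟨HasRightTrace.reflect, fun h' => ?_⟩
        ((leftCalculus hab hα hα1).tr_iff _ _ h)
      have := h'.reflect
      rwa [reflect_reflect] at this
    const := (leftCalculus hab hα hα1).const
    const_nonneg := (leftCalculus hab hα hα1).const_nonneg
    poincare := fun u v h h0 => by
      have : ‖reflect a b u‖ ≤ (leftCalculus hab hα hα1).const * ‖reflect a b v‖ :=
        (leftCalculus hab hα hα1).poincare _ _ h h0
      rwa [norm_reflect, norm_reflect] at this
    coef_of_opp := fun u v h h0 =>
      (leftCalculus hab hα hα1).coef_of_opp _ _ h (HasLeftTrace.reflect h0) }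

/-! ### Lax-Milgram and quadratic minimization -/

section Abstract

variable {X : Type*} [NormedAddCommGroup X] [InnerProductSpace ℝ X]

/-- Existence and uniqueness for the variational equation of a coercive bilinear form. -/
lemma existsUnique_of_isCoercive [CompleteSpace X] {B : X →L[ℝ] X →L[ℝ] ℝ} (hB : IsCoercive B)
    (l : X →L[ℝ] ℝ) : ∃! x, ∀ y, B x y = l y := by
  refine ⟨hB.continuousLinearEquivOfBilin.symm ((InnerProductSpace.toDual ℝ X).symm l),
    fun y => ?_, fun x hx => ?_⟩
  · rw [← hB.continuousLinearEquivOfBilin_apply, ContinuousLinearEquiv.apply_symm_apply,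
      InnerProductSpace.toDual_symm_apply]
  · rw [ContinuousLinearEquiv.eq_symm_apply]
    refine (hB.unique_continuousLinearEquivOfBilin fun w => ?_).symm
    rw [InnerProductSpace.toDual_symm_apply, hx]

/-- The minimizers of a convex quadratic functional are the solutions of its Euler equation. -/
lemma isMin_quadratic_iff {B : X →L[ℝ] X →L[ℝ] ℝ} (hsymm : ∀ x y, B x y = B y x)
    (hpos : ∀ x, 0 ≤ B x x) (l : X →L[ℝ] ℝ) (x : X) :
    (∀ y, 1 / 2 * B x x - l x ≤ 1 / 2 * B y y - l y) ↔ ∀ y, B x y = l y := by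
  have key : ∀ (z : X) (t : ℝ), 1 / 2 * B (x + t • z) (x + t • z) - l (x + t • z)
      = (1 / 2 * B x x - l x) + t * (B x z - l z) + t ^ 2 / 2 * B z z := by
    intro z t
    simp only [map_add, map_smul, add_apply, smul_apply, smul_eq_mul, hsymm z x]
    ring
  constructor
  · intro h z
    -- With d the defect and q = B z z, the step -d/(q + 1) is well defined even for q = 0 and
    -- strictly lowers the energy unless d = 0.
    have h1 := h (x + (-(B x z - l z) / (B z z + 1)) • z)
    rw [key] at h1
    have hq := hpos z
    set d := B x z - l z with hd
    set q := B z z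
    have e : -d / (q + 1) * d + (-d / (q + 1)) ^ 2 / 2 * q
        = -(d ^ 2 * (q + 2) / (2 * (q + 1) ^ 2)) := by
      field_simp
      ring
    have h2 : d ^ 2 * (q + 2) / (2 * (q + 1) ^ 2) ≤ 0 := by linarith
    have h3 : d = 0 := by
      by_contra hne
      have : 0 < d ^ 2 * (q + 2) / (2 * (q + 1) ^ 2) := by positivity
      linarith
    linarith
  · intro h y
    have h1 := key (y - x) 1
    rw [one_smul, add_sub_cancel, h (y - x), sub_self] at h1
    rw [h1]
    have := hpos (y - x)
    linarith

end Abstract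

/-! ### One-sided constraints as closed subspaces -/

section Side

variable {a b : ℝ} {H : Set (L2 a b)} {D : L2 a b → ℝ → ℝ} {Coef Tr Opp : L2 a b → Prop}

open Classical in
/-- The part of the graph with vanishing trace (if `active`), and vanishing singular coefficient
(if `ring`); if not `active`, pairs with second component zero. -/
noncomputable def OneSidedCalculus.side (K : OneSidedCalculus a b H D Coef Tr Opp)
    (active ring : Prop) : Submodule ℝ (L2 a b × L2 a b) :=
  if active then K.graph ⊓ K.tr.ker ⊓ (if ring then K.coef.ker else ⊤)
  -- A derivative absent from the form is pinned to zero; left free, it would destroy coercivity.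
  else (ContinuousLinearMap.snd ℝ (L2 a b) (L2 a b)).ker

lemma OneSidedCalculus.isClosed_side (K : OneSidedCalculus a b H D Coef Tr Opp)
    (active ring : Prop) : IsClosed (K.side active ring : Set (L2 a b × L2 a b)) := by
  rw [side]
  split_ifs
  · exact (K.isClosed_graph.inter K.tr.isClosed_ker).inter K.coef.isClosed_ker
  · exact (K.isClosed_graph.inter K.tr.isClosed_ker).inter isClosed_univ
  · exact ContinuousLinearMap.isClosed_ker _

lemma OneSidedCalculus.mem_side_of_active (K : OneSidedCalculus a b H D Coef Tr Opp)
    {active ring : Prop} (h : active) {u v : L2 a b} :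
    (u, v) ∈ K.side active ring ↔ (u, v) ∈ K.graph ∧ Tr u ∧ (ring → Coef u) := by
  rw [side, if_pos h]
  constructor
  · rintro ⟨⟨h1, h2⟩, h3⟩
    refine ⟨h1, (K.tr_iff u v h1).2 h2, fun hr => (K.coef_iff u v h1).2 ?_⟩
    rw [if_pos hr] at h3
    exact h3
  · rintro ⟨h1, h2, h3⟩
    refine ⟨⟨h1, (K.tr_iff u v h1).1 h2⟩, ?_⟩
    split_ifs with hr
    · exact (K.coef_iff u v h1).1 (h3 hr)
    · trivial

lemma OneSidedCalculus.mem_side_of_not_active (K : OneSidedCalculus a b H D Coef Tr Opp)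
    {active ring : Prop} (h : ¬active) {u v : L2 a b} :
    (u, v) ∈ K.side active ring ↔ v = 0 := by
  rw [side, if_neg h]
  exact Iff.rfl

lemma OneSidedCalculus.exists_mem_side (K : OneSidedCalculus a b H D Coef Tr Opp)
    {active ring : Prop} {u : L2 a b} :
    (∃ v, (u, v) ∈ K.side active ring) ↔ (active → u ∈ H ∧ Tr u ∧ (ring → Coef u)) := by
  by_cases h : active
  · rw [imp_iff_right h, K.mem_iff, ← exists_and_right]
    exact exists_congr fun v => K.mem_side_of_active h
  · exact iff_of_true ⟨0, (K.mem_side_of_not_active h).2 rfl⟩ fun h' => absurd h' h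

end Side

/-- The five cases split into independent left and right conditions, the shape that `side` encodes.
-/
lemma mem_zeroSpace_iff {a b α θ lam : ℝ} (u : L2 a b) :
    u ∈ zeroSpace α a b θ lam ↔
      (θ ≠ 1 → u ∈ leftH α a b ∧ HasLeftTrace a b u 0 ∧
        (θ = 0 ∧ lam = 0 → HasLeftCoeff α a b u 0)) ∧
      (θ ≠ 0 → u ∈ rightH α a b ∧ HasRightTrace a b u 0 ∧
        (θ = 1 ∧ lam = 0 → HasRightCoeff α a b u 0)) := by
  simp only [zeroSpace, space, leftRingH, rightRingH, mem_ofPred_eq]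
  by_cases h0 : θ = 0
  · subst h0
    by_cases hl : lam = 0 <;> (simp [hl]; try tauto)
  · by_cases h1 : θ = 1
    · subst h1
      by_cases hl : lam = 0 <;> (simp [hl]; try tauto)
    · simp [h0, h1]
      tauto

/-! ### The Hilbert space of triples and coercivity -/

/-- The Hilbert space of triples `(u, p, q)` of square integrable functions. -/
abbrev Triple (a b : ℝ) : Type := PiLp 2 (fun _ : Fin 3 => L2 a b)

/-- The components of a triple. -/
noncomputable def comp (a b : ℝ) (i : Fin 3) : Triple a b →L[ℝ] L2 a b :=
  PiLp.proj 2 (fun _ : Fin 3 => L2 a b) i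

/-- The triples `(u, ⁻D u, ⁺D u)` for `u` in the zero-trace space, where an unused derivative is
replaced by `0`. -/
noncomputable def tripleSpace {a b α : ℝ} (hab : a < b) (hα : 1 / 2 < α) (hα1 : α < 1)
    (θ lam : ℝ) : Submodule ℝ (Triple a b) :=
  ((leftCalculus hab hα hα1).side (θ ≠ 1) (θ = 0 ∧ lam = 0)).comap
      ((comp a b 0).prod (comp a b 1)).toLinearMap ⊓
    ((rightCalculus hab hα hα1).side (θ ≠ 0) (θ = 1 ∧ lam = 0)).comap
      ((comp a b 0).prod (comp a b 2)).toLinearMap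

section Main

variable {a b α θ lam : ℝ} (hab : a < b) (hα : 1 / 2 < α) (hα1 : α < 1)

lemma mem_tripleSpace {w : Triple a b} : w ∈ tripleSpace hab hα hα1 θ lam ↔
    (w 0, w 1) ∈ (leftCalculus hab hα hα1).side (θ ≠ 1) (θ = 0 ∧ lam = 0) ∧
      (w 0, w 2) ∈ (rightCalculus hab hα hα1).side (θ ≠ 0) (θ = 1 ∧ lam = 0) := Iff.rfl

lemma isClosed_tripleSpace :
    IsClosed (tripleSpace hab hα hα1 θ lam : Set (Triple a b)) :=
  (((leftCalculus hab hα hα1).isClosed_side _ _).preimage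
      ((comp a b 0).prod (comp a b 1)).continuous).inter
    (((rightCalculus hab hα hα1).isClosed_side _ _).preimage
      ((comp a b 0).prod (comp a b 2)).continuous)

lemma mem_zeroSpace_iff_exists (u : L2 a b) :
    u ∈ zeroSpace α a b θ lam ↔ ∃ w : tripleSpace hab hα hα1 θ lam, (w : Triple a b) 0 = u := by
  rw [mem_zeroSpace_iff, ← (leftCalculus hab hα hα1).exists_mem_side,
    ← (rightCalculus hab hα hα1).exists_mem_side]
  constructor
  · rintro ⟨⟨p, hp⟩, ⟨q, hq⟩⟩
    exact ⟨⟨WithLp.toLp 2 ![u, p, q], (mem_tripleSpace hab hα hα1).2 ⟨hp, hq⟩⟩, rfl⟩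
  · rintro ⟨⟨w, hw⟩, rfl⟩
    exact ⟨⟨_, ((mem_tripleSpace hab hα hα1).1 hw).1⟩, ⟨_, ((mem_tripleSpace hab hα hα1).1 hw).2⟩⟩

/-- The inner product of `L²` as a bounded bilinear form. -/
noncomputable def innerForm (a b : ℝ) : L2 a b →L[ℝ] L2 a b →L[ℝ] ℝ :=
  innerSL ℝ

/-- The bilinear form on triples. -/
noncomputable def tripleForm (a b θ lam : ℝ) : Triple a b →L[ℝ] Triple a b →L[ℝ] ℝ :=
  (1 - θ) • (innerForm a b).bilinearComp (comp a b 1) (comp a b 1)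
    + θ • (innerForm a b).bilinearComp (comp a b 2) (comp a b 2)
    + lam • (innerForm a b).bilinearComp (comp a b 0) (comp a b 0)

lemma tripleForm_apply (w z : Triple a b) : tripleForm a b θ lam w z =
    (1 - θ) * inner ℝ (w 1) (z 1) + θ * inner ℝ (w 2) (z 2) + lam * inner ℝ (w 0) (z 0) := rfl

lemma inner_eq (u v : L2 a b) : inner ℝ u v = ∫ x in Ioo a b, u x * v x := by
  rw [L2.inner_def]
  congr 1 with x
  simp [mul_comm]

lemma integrable_mul_L2 (u v : L2 a b) : Integrable (fun x => u x * v x) (vol a b) :=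
  (Lp.memLp u).integrable_mul (Lp.memLp v)

/-- For θ = 1 nothing is known about the left derivative of u, but its coefficient 1 - θ is then
zero. -/
lemma left_ae_eq (w : tripleSpace hab hα hα1 θ lam) :
    ∀ᵐ x ∂vol a b, θ ≠ 1 →
      leftWeakDeriv α a b ((w : Triple a b) 0) x = (w : Triple a b) 1 x := by
  by_cases h : θ = 1
  · simp [h]
  · have := (((leftCalculus hab hα hα1).mem_side_of_active h).1
      ((mem_tripleSpace hab hα hα1).1 w.2).1).1
    filter_upwards [(leftCalculus hab hα hα1).deriv_ae_eq _ _ this] with x hx _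
    exact hx

lemma right_ae_eq (w : tripleSpace hab hα hα1 θ lam) :
    ∀ᵐ x ∂vol a b, θ ≠ 0 →
      rightWeakDeriv α a b ((w : Triple a b) 0) x = (w : Triple a b) 2 x := by
  by_cases h : θ = 0
  · simp [h]
  · have := (((rightCalculus hab hα hα1).mem_side_of_active h).1
      ((mem_tripleSpace hab hα hα1).1 w.2).2).1
    filter_upwards [(rightCalculus hab hα hα1).deriv_ae_eq _ _ this] with x hx _
    exact hx

lemma bilin_integrand_ae_eq (w z : tripleSpace hab hα hα1 θ lam) :
    (fun x => (1 - θ) * ((w : Triple a b) 1 x * (z : Triple a b) 1 x)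
      + θ * ((w : Triple a b) 2 x * (z : Triple a b) 2 x)
      + lam * ((w : Triple a b) 0 x * (z : Triple a b) 0 x)) =ᵐ[vol a b]
    fun x => (1 - θ) * (leftWeakDeriv α a b ((w : Triple a b) 0) x
        * leftWeakDeriv α a b ((z : Triple a b) 0) x)
      + θ * (rightWeakDeriv α a b ((w : Triple a b) 0) x
        * rightWeakDeriv α a b ((z : Triple a b) 0) x)
      + lam * ((w : Triple a b) 0 x * (z : Triple a b) 0 x) := by
  filter_upwards [left_ae_eq hab hα hα1 w, left_ae_eq hab hα hα1 z, right_ae_eq hab hα hα1 w,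
    right_ae_eq hab hα hα1 z] with x h1 h2 h3 h4
  by_cases h0 : θ = 0
  · simp [h0, h1 (by simp [h0]), h2 (by simp [h0])]
  · by_cases h11 : θ = 1
    · simp [h11, h3 h0, h4 h0]
    · simp only [h1 h11, h2 h11, h3 h0, h4 h0]

lemma integrable_bilin (w z : tripleSpace hab hα hα1 θ lam) :
    Integrable (fun x => (1 - θ) * (leftWeakDeriv α a b ((w : Triple a b) 0) x
        * leftWeakDeriv α a b ((z : Triple a b) 0) x)
      + θ * (rightWeakDeriv α a b ((w : Triple a b) 0) x
        * rightWeakDeriv α a b ((z : Triple a b) 0) x)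
      + lam * ((w : Triple a b) 0 x * (z : Triple a b) 0 x)) (vol a b) :=
  ((((integrable_mul_L2 _ _).const_mul _).add ((integrable_mul_L2 _ _).const_mul _)).add
    ((integrable_mul_L2 _ _).const_mul _)).congr (bilin_integrand_ae_eq hab hα hα1 w z)

lemma bilin_eq (w z : tripleSpace hab hα hα1 θ lam) :
    bilin α a b θ lam ((w : Triple a b) 0) ((z : Triple a b) 0) =
      tripleForm a b θ lam w z := by
  have i1 := (integrable_mul_L2 ((w : Triple a b) 1) ((z : Triple a b) 1)).const_mul (1 - θ)
  have i2 := (integrable_mul_L2 ((w : Triple a b) 2) ((z : Triple a b) 2)).const_mul θ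
  have i3 := (integrable_mul_L2 ((w : Triple a b) 0) ((z : Triple a b) 0)).const_mul lam
  rw [bilin, ← integral_congr_ae (bilin_integrand_ae_eq hab hα hα1 w z), tripleForm_apply, inner_eq,
    inner_eq, inner_eq, ← integral_const_mul, ← integral_const_mul, ← integral_const_mul,
    ← integral_add i1 i2]
  exact integral_add (i1.add i2) i3

lemma load_eq {f : ℝ → ℝ} (hf : MemLp f 2 (vol a b)) (v : L2 a b) :
    load a b f v = pairing hf v := by
  rw [pairing_apply, load]
  simp only [mul_comm]

lemma energy_eq {f : ℝ → ℝ} (hf : MemLp f 2 (vol a b)) (w : tripleSpace hab hα hα1 θ lam) :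
    energy α a b θ lam f ((w : Triple a b) 0) =
      1 / 2 * tripleForm a b θ lam w w - pairing hf ((w : Triple a b) 0) := by
  rw [← bilin_eq hab hα hα1 w w, ← load_eq, energy, bilin, load, ← integral_const_mul]
  refine Eq.trans ?_ (integral_sub ((integrable_bilin hab hα hα1 w w).const_mul _)
    (hf.integrable_mul (Lp.memLp ((w : Triple a b) 0))))
  congr 1 with x
  simp only [sq_abs]
  ring

lemma tripleForm_symm (w z : Triple a b) :
    tripleForm a b θ lam w z = tripleForm a b θ lam z w := by
  simp only [tripleForm_apply, real_inner_comm]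

lemma tripleForm_self (w : Triple a b) : tripleForm a b θ lam w w =
    (1 - θ) * ‖w 1‖ ^ 2 + θ * ‖w 2‖ ^ 2 + lam * ‖w 0‖ ^ 2 := by
  simp only [tripleForm_apply, real_inner_self_eq_norm_sq]

/-- Each of the three components is bounded by the form separately. A derivative is either weighted
positively or zero by construction; u itself is controlled by lam = 1 or by the Poincaré inequality.
-/
lemma tripleForm_coercive (hθ0 : 0 ≤ θ) (hθ1 : θ ≤ 1) (hlam : lam = 0 ∨ lam = 1) :
    IsCoercive ((tripleForm a b θ lam).bilinearComp (tripleSpace hab hα hα1 θ lam).subtypeL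
      (tripleSpace hab hα hα1 θ lam).subtypeL) := by
  have hl : 0 ≤ lam := by rcases hlam with rfl | rfl <;> norm_num
  have hmem := fun w : tripleSpace hab hα hα1 θ lam => (mem_tripleSpace hab hα hα1).1 w.2
  have e1 : ∃ K : ℝ, 0 ≤ K ∧ ∀ w : tripleSpace hab hα hα1 θ lam,
      ‖(w : Triple a b) 1‖ ^ 2 ≤ K * tripleForm a b θ lam w w := by
    by_cases h : θ = 1
    · refine ⟨0, le_rfl, fun w => ?_⟩
      rw [((leftCalculus hab hα hα1).mem_side_of_not_active (not_not.2 h)).1 (hmem w).1]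
      simp
    · have hpos : 0 < 1 - θ := sub_pos.2 (lt_of_le_of_ne hθ1 h)
      refine ⟨(1 - θ)⁻¹, by positivity, fun w => ?_⟩
      rw [tripleForm_self, le_inv_mul_iff₀ hpos, add_assoc]
      exact le_add_of_nonneg_right (by positivity)
  have e2 : ∃ K : ℝ, 0 ≤ K ∧ ∀ w : tripleSpace hab hα hα1 θ lam,
      ‖(w : Triple a b) 2‖ ^ 2 ≤ K * tripleForm a b θ lam w w := by
    by_cases h : θ = 0
    · refine ⟨0, le_rfl, fun w => ?_⟩
      rw [((rightCalculus hab hα hα1).mem_side_of_not_active (not_not.2 h)).1 (hmem w).2]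
      simp
    · have hpos : 0 < θ := lt_of_le_of_ne hθ0 (Ne.symm h)
      have : 0 ≤ 1 - θ := sub_nonneg.2 hθ1
      refine ⟨θ⁻¹, by positivity, fun w => ?_⟩
      rw [tripleForm_self, le_inv_mul_iff₀ hpos]
      have h1 : 0 ≤ (1 - θ) * ‖(w : Triple a b) 1‖ ^ 2 := by positivity
      have h2 : 0 ≤ lam * ‖(w : Triple a b) 0‖ ^ 2 := by positivity
      linarith
  obtain ⟨K1, hK1, hw1⟩ := e1
  obtain ⟨K2, hK2, hw2⟩ := e2
  have e0 : ∃ K : ℝ, 0 ≤ K ∧ ∀ w : tripleSpace hab hα hα1 θ lam,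
      ‖(w : Triple a b) 0‖ ^ 2 ≤ K * tripleForm a b θ lam w w := by
    rcases hlam with hlam | hlam
    · have hbound : ∀ {C x y s K : ℝ}, 0 ≤ x → x ≤ C * y → y ^ 2 ≤ K * s →
          x ^ 2 ≤ C ^ 2 * K * s := by
        intro C x y s K hx hxy hy
        calc x ^ 2 ≤ (C * y) ^ 2 := pow_le_pow_left₀ hx hxy 2
          _ = C ^ 2 * y ^ 2 := by ring
          _ ≤ C ^ 2 * (K * s) := mul_le_mul_of_nonneg_left hy (sq_nonneg C)
          _ = C ^ 2 * K * s := by ring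
      by_cases h : θ = 1
      · have h0 : θ ≠ 0 := by simp [h]
        refine ⟨(rightCalculus hab hα hα1).const ^ 2 * K2, by positivity, fun w => ?_⟩
        obtain ⟨hg, -, hc⟩ := ((rightCalculus hab hα hα1).mem_side_of_active h0).1 (hmem w).2
        exact hbound (norm_nonneg _) ((rightCalculus hab hα hα1).poincare _ _ hg
          (((rightCalculus hab hα hα1).coef_iff _ _ hg).1 (hc ⟨h, hlam⟩))) (hw2 w)
      · refine ⟨(leftCalculus hab hα hα1).const ^ 2 * K1, by positivity, fun w => ?_⟩
        obtain ⟨hg, -, hc⟩ := ((leftCalculus hab hα hα1).mem_side_of_active h).1 (hmem w).1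
        refine hbound (norm_nonneg _) ((leftCalculus hab hα hα1).poincare _ _ hg ?_) (hw1 w)
        by_cases h0 : θ = 0
        · exact ((leftCalculus hab hα hα1).coef_iff _ _ hg).1 (hc ⟨h0, hlam⟩)
        -- For 0 < θ < 1 the right trace at a is available, and its existence removes the singular
        -- part at a.
        · exact (leftCalculus hab hα hα1).coef_of_opp _ _ hg
            (((rightCalculus hab hα hα1).mem_side_of_active h0).1 (hmem w).2).2.1
    · refine ⟨1, zero_le_one, fun w => ?_⟩
      have : 0 ≤ 1 - θ := sub_nonneg.2 hθ1
      have h1 : lam * ‖(w : Triple a b) 0‖ ^ 2 = ‖(w : Triple a b) 0‖ ^ 2 := by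
        simp only [hlam, one_mul]
      rw [tripleForm_self, one_mul, h1]
      exact le_add_of_nonneg_left (by positivity)
  obtain ⟨K0, hK0, hw0⟩ := e0
  -- The added 1 keeps the constant positive even if all three bounds are zero.
  refine ⟨(K0 + K1 + K2 + 1)⁻¹, by positivity, fun w => ?_⟩
  have hw : ‖w‖ ^ 2 = ‖(w : Triple a b) 0‖ ^ 2 + ‖(w : Triple a b) 1‖ ^ 2
      + ‖(w : Triple a b) 2‖ ^ 2 := by
    rw [Submodule.coe_norm, PiLp.norm_sq_eq_of_L2, Fin.sum_univ_three]
  change _ ≤ tripleForm a b θ lam w w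
  have hnn : 0 ≤ tripleForm a b θ lam w w := by
    have : 0 ≤ 1 - θ := sub_nonneg.2 hθ1
    rw [tripleForm_self]
    positivity
  rw [mul_assoc, ← sq, inv_mul_le_iff₀ (by positivity), hw]
  linarith [hw0 w, hw1 w, hw2 w]

end Main

end FracVar

/-! ### Transfer from triples to the zero-trace space -/

theorem mainTheorem3 (a b : ℝ) (hab : a < b) (α : ℝ) (hα : 1 / 2 < α) (hα1 : α < 1)
    (θ : ℝ) (hθ0 : 0 ≤ θ) (hθ1 : θ ≤ 1) (lam : ℝ) (hlam : lam = 0 ∨ lam = 1)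
    (f : ℝ → ℝ) (hf : MemLp f 2 (FracVar.vol a b)) :
    (∀ u ∈ FracVar.zeroSpace α a b θ lam,
      FracVar.IsMinimizer α a b θ lam f u ↔ FracVar.IsWeakSolution α a b θ lam f u) ∧
    (∃! u : FracVar.L2 a b, FracVar.IsWeakSolution α a b θ lam f u) ∧
    (∃! u : FracVar.L2 a b, FracVar.IsMinimizer α a b θ lam f u) := by
  set W := FracVar.tripleSpace hab hα hα1 θ lam with hW
  set B := (FracVar.tripleForm a b θ lam).bilinearComp W.subtypeL W.subtypeL with hB
  set l : W →L[ℝ] ℝ := (FracVar.pairing hf) ∘L (FracVar.comp a b 0) ∘L W.subtypeL with hl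
  have hcoer : IsCoercive B := FracVar.tripleForm_coercive hab hα hα1 hθ0 hθ1 hlam
  have : CompleteSpace W := (FracVar.isClosed_tripleSpace hab hα hα1).completeSpace_coe
  have hpos : ∀ w, 0 ≤ B w w := fun w => by
    obtain ⟨C, hC, h⟩ := hcoer
    exact le_trans (by positivity) (h w)
  have hmem := FracVar.mem_zeroSpace_iff_exists (θ := θ) (lam := lam) hab hα hα1
  have hweak : ∀ w : W, FracVar.IsWeakSolution α a b θ lam f ((w : FracVar.Triple a b) 0) ↔
      ∀ z, B w z = l z := by
    intro w
    constructor
    · intro h z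
      have := h.2 _ ((hmem _).2 ⟨z, rfl⟩)
      rwa [FracVar.bilin_eq hab hα hα1 w z, FracVar.load_eq hf] at this
    · refine fun h => ⟨(hmem _).2 ⟨w, rfl⟩, fun v hv => ?_⟩
      obtain ⟨z, rfl⟩ := (hmem v).1 hv
      rw [FracVar.bilin_eq hab hα hα1 w z, FracVar.load_eq hf]
      exact h z
  have hmin : ∀ w : W, FracVar.IsMinimizer α a b θ lam f ((w : FracVar.Triple a b) 0) ↔
      ∀ z, 1 / 2 * B w w - l w ≤ 1 / 2 * B z z - l z := by
    intro w
    constructor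
    · intro h z
      have := h.2 _ ((hmem _).2 ⟨z, rfl⟩)
      rwa [FracVar.energy_eq hab hα hα1 hf w, FracVar.energy_eq hab hα hα1 hf z] at this
    · refine fun h => ⟨(hmem _).2 ⟨w, rfl⟩, fun v hv => ?_⟩
      obtain ⟨z, rfl⟩ := (hmem v).1 hv
      rw [FracVar.energy_eq hab hα hα1 hf w, FracVar.energy_eq hab hα hα1 hf z]
      exact h z
  have hiff : ∀ u ∈ FracVar.zeroSpace α a b θ lam,
      FracVar.IsMinimizer α a b θ lam f u ↔ FracVar.IsWeakSolution α a b θ lam f u := by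
    intro u hu
    obtain ⟨w, rfl⟩ := (hmem u).1 hu
    rw [hmin, hweak]
    have hsymm : ∀ x y, B x y = B y x := fun x y =>
      FracVar.tripleForm_symm (x : FracVar.Triple a b) y
    exact FracVar.isMin_quadratic_iff hsymm hpos l w
  have hex : ∃! u : FracVar.L2 a b, FracVar.IsWeakSolution α a b θ lam f u := by
    obtain ⟨w, hw, hwu⟩ := FracVar.existsUnique_of_isCoercive hcoer l
    -- Uniqueness descends to u because every weak solution is the first component of a triple
    -- solving the abstract equation.
    refine ⟨_, (hweak w).2 hw, fun u hu => ?_⟩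
    obtain ⟨z, rfl⟩ := (hmem u).1 hu.1
    rw [hwu z ((hweak z).1 hu)]
  refine ⟨hiff, hex, ?_⟩
  obtain ⟨u, hu, huu⟩ := hex
  exact ⟨u, (hiff u hu.1).2 hu, fun v hv => huu v ((hiff v hv.1).1 hv)⟩
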